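/- Let $\mathbb{P}^*$ be the set of finite words over the positive integers, including the empty word, ordered by generalized factor order: $u\le w$ if $w$ has consecutive letters $w(i+1)\dots w(i+n)$, $n=|u|$, with $u(j)\le w(i+j)$ for $1\le j\le n$. Let $\mu$ be its Möbius function and $\rho$ its rank function (the sum of the letters), and $\rho(u,w)=\rho(w)-\rho(u)$. A word is flat if all its letters are $1$. Put $v(j)=0$ for $j>|v|$. **Reducing letters.** Reducing a letter $a>1$ replaces it by $a-1$; reducing a letter $1$ removes it. The letter $w(i)$ is reducible if $w(i)>1$, or $i=1$, or $i=|w|$ and $w$ is not flat. **Chains.** Let $C: w=v_0\to v_1\to\dots\to v_n=u$ be a maximal chain of $[u,w]$ (each $v_{k-1}$ covers $v_k$). Starting from $w$, each $v_k$ is obtained from $v_{k-1}$ by reducing one reducible letter, a removed letter being replaced by the placeholder $0$; let $l_k$ be the position of that letter in $w$. If $v_{k-1}$ is flat, only its first letter may be reduced. The sequence $l_1\dots l_n$ is the chain id of $C$, and maximal chains are ordered lexicographically by chain id. A non-empty open interval $C(v_i,v_j)=\{v_{i+1},\dots,v_{j-1}\}$ of $C$ is skipped if $C\setminus C(v_i,v_j)\subset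 C'$ for some maximal chain $C'<C$ of $[u,w]$; a minimal skipped interval is an MSI. Let $I_1,I_2,\dots$ be the MSIs of $C$ in the order in which they are met along $C$. The family $J(C)$ is built as follows: put $J_1=I_1$, subtract $J_1$ from every other $I_k$, discard the resulting sets that are not containment-minimal, let $J_2$ be the first that remains, and continue in the same way until nothing is left. The chain $C$ is critical if $\bigcup J(C)=\{v_1,\dots,v_{n-1}\}$. The word $v_k$ $(0<k<n)$ is a strong descent if $l_k>l_{k+1}$ and $v_{k-1}\ne v_{k+1}11$. For $u\le w$ let $t$ be the number of critical chains of $[u,w]$ in which all of $v_1,\dots,v_{n-1}$ are strong descents, and $$d(u,w)=\begin{cases}t\,(-1)^{\rho(u,w)}&\text{if }\rho(u,w)>1,\\(-1)^{\rho(u,w)}&\text{if }\rho(u,w)\le1.\end{cases}$$ **Principal factors.** A word $p$ is an outer factor of $v$ if $|p|<|v|$ and $p$ is dominated letter by letter both by the first $|p|$ letters and by the last $|p|$ letters of $v$; it is a suffix of a word $y$ if $|p|\le|y|$ and it is dominated by the last $|p|$ letters of $y$. An outer factor of $v$ is maximal if it is not a factor of a longer outer factor of $v$. Let $p$ be a maximal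 outer factor of $v$ that is not flat. Its principal index in $v$ is the smallest $i$ such that $v(i)>p(i)$ and $v(i)$ is reducible. Let $v'$ be $v$ with the letter at the principal index reduced; $p$ is a principal factor of $v$ if $p$ is not a suffix of $v'$. For a word $y$, let $y\setminus1^m$ be $y$ with $m$ letters $1$ removed from its end, undefined if $y$ does not end in $m$ ones. The primary prefix $x(p)$ of a principal factor $p$ of $v$ is $p\setminus1^m$ for the smallest $m>0$ such that this word is defined and is an outer factor of $v'$; it is undefined if there is no such $m$. **Bases.** A word $v$ is a base of $w$ of degree $i$ if $|v|\in\{|w|,|w|-1\}$, $v(j)\in\{w(j),w(j)-1\}$ for $1\le j\le|w|$, and $v(j)=w(j)-1$ for exactly $i$ of these $j$. A principal factor of $w$ of degree $i$ with base $v$ is a principal factor $p$ of such a $v$ whose principal index in $v$ is smaller than every $j$ with $v(j)=w(j)-1$. Write $v_i$ for the base, $p_{v_i}$ for the principal factor and $x(p_{v_i})$ for its primary prefix. Let $\nu(u,v)=\sum_{i\ge0}\mu(u,v\setminus1^i)$, where undefined words contribute $0$, and $\nu(u,v)=0$ if $v$ is undefined. **Theorem.** If $u\le w$ in $\mathbb{P}^*$,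 then $$\mu(u,w)=d(u,w)+\sum(-1)^i\bigl(\nu(u,p_{v_i})-\nu(u,x(p_{v_i}))\bigr),$$ where the sum is over all triples $v_i,\,p_{v_i},\,x(p_{v_i})$ such that $p_{v_i}$ is a principal factor of $w$ of degree $i$ with base $v_i$ and primary prefix $x(p_{v_i})$ (which may be undefined). -/

import Mathlib

/-- Words over the positive integers. -/
@[ext]
structure PWord where
  /-- The list of letters of the word. -/
  letters : List ℕ+

namespace PWord

instance instDecidableEq : DecidableEq PWord := fun u w =>
  decidable_of_iff (u.letters = w.letters) PWord.ext_iff.symm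

/-- The empty word. -/
def nil : PWord := ⟨[]⟩

/-- The length `|w|`. -/
def len (w : PWord) : ℕ := w.letters.length

/-- The `i`-th letter of `w` as a natural number. Positions are counted from `0`, and the letter is
`0` beyond the end of the word. -/
def letter (w : PWord) (i : ℕ) : ℕ := (w.letters.map PNat.val).getD i 0

/-- Generalized factor order: `u ≤ w` if some string of consecutive letters of `w` has the
length of `u` and dominates `u` letter by letter. -/
def IsFactor (u w : PWord) : Prop :=
  ∃ s : List ℕ+, s <:+: w.letters ∧ List.Forall₂ (· ≤ ·) u.letters s

theorem isFactor_refl (w : PWord) : IsFactor w w :=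
  ⟨w.letters, List.infix_rfl, List.forall₂_refl _⟩

theorem forall₂_le_trans : ∀ {a b c : List ℕ+},
    List.Forall₂ (· ≤ ·) a b → List.Forall₂ (· ≤ ·) b c → List.Forall₂ (· ≤ ·) a c
  | _, _, _, .nil, .nil => .nil
  | _, _, _, .cons h t, .cons h' t' => .cons (h.trans h') (forall₂_le_trans t t')

theorem forall₂_le_antisymm : ∀ {a b : List ℕ+},
    List.Forall₂ (· ≤ ·) a b → List.Forall₂ (· ≤ ·) b a → a = b
  | _, _, .nil, .nil => rfl
  | _, _, .cons h t, .cons h' t' => by rw [le_antisymm h h', forall₂_le_antisymm t t']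

theorem forall₂_infix {s t v : List ℕ+} (h : List.Forall₂ (· ≤ ·) s t) (hv : v <:+: s) :
    ∃ v', v' <:+: t ∧ List.Forall₂ (· ≤ ·) v v' := by
  obtain ⟨a, b, rfl⟩ := hv
  have h1 := List.forall₂_take (a.length + v.length) h
  have h2 := List.forall₂_drop a.length h1
  refine ⟨(t.take (a.length + v.length)).drop a.length,
    (List.drop_suffix _ _).isInfix.trans (List.take_prefix _ _).isInfix, ?_⟩
  simpa [List.take_append] using h2

theorem IsFactor.trans {u v w : PWord} (h : IsFactor u v) (h' : IsFactor v w) : IsFactor u w := by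
  obtain ⟨s, hs, hus⟩ := h
  obtain ⟨t, ht, hvt⟩ := h'
  obtain ⟨s', hs', hss'⟩ := forall₂_infix hvt hs
  exact ⟨s', hs'.trans ht, forall₂_le_trans hus hss'⟩

theorem IsFactor.len_le {u w : PWord} (h : IsFactor u w) : len u ≤ len w := by
  obtain ⟨s, hs, hus⟩ := h
  exact hus.length_eq.le.trans hs.length_le

theorem IsFactor.antisymm {u w : PWord} (h : IsFactor u w) (h' : IsFactor w u) : u = w := by
  have hl : len u = len w := le_antisymm h.len_le h'.len_le
  obtain ⟨s, hs, hus⟩ := h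
  obtain ⟨t, ht, hwt⟩ := h'
  have e1 : s = w.letters := hs.eq_of_length (hus.length_eq.symm.trans hl)
  have e2 : t = u.letters := ht.eq_of_length (hwt.length_eq.symm.trans hl.symm)
  rw [e1] at hus
  rw [e2] at hwt
  exact PWord.ext (forall₂_le_antisymm hus hwt)

instance instPartialOrder : PartialOrder PWord where
  le := IsFactor
  le_refl := isFactor_refl
  le_trans _ _ _ := IsFactor.trans
  le_antisymm _ _ := IsFactor.antisymm

theorem finite_forall₂ (s : List ℕ+) : {v : List ℕ+ | List.Forall₂ (· ≤ ·) v s}.Finite := by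
  induction s with
  | nil => simp
  | cons a s ih =>
    refine (((Set.finite_Iic a).prod ih).image fun q => q.1 :: q.2).subset ?_
    rintro v hv
    obtain ⟨b, t, hb, ht, rfl⟩ := List.forall₂_cons_right_iff.1 hv
    exact ⟨(b, t), ⟨hb, ht⟩, rfl⟩

theorem finite_Iic (w : PWord) : (Set.Iic w).Finite := by
  have h : {s : List ℕ+ | s <:+: w.letters}.Finite := by
    refine (List.finite_toSet (w.letters.inits.flatMap List.tails)).subset ?_
    intro s hs
    obtain ⟨t, h1, h2⟩ := List.infix_iff_suffix_prefix.1 hs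
    simp only [Set.mem_ofPred_eq, List.mem_flatMap, List.mem_inits, List.mem_tails]
    exact ⟨t, h2, h1⟩
  refine ((h.biUnion fun s _ => finite_forall₂ s).image PWord.mk).subset ?_
  rintro v ⟨s, hs, hv⟩
  exact ⟨v.letters, Set.mem_biUnion (x := s) hs hv, rfl⟩

/-- Closed intervals are finite, so that the Möbius function `IncidenceAlgebra.mu` is defined. -/
noncomputable instance instLocallyFiniteOrder : LocallyFiniteOrder PWord :=
  LocallyFiniteOrder.ofFiniteIcc fun _ w => (finite_Iic w).subset Set.Icc_subset_Iic_self

/-- A word is flat if all its letters are `1`. -/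
def Flat (w : PWord) : Prop := ∀ a ∈ w.letters, a = 1

/-- The letter of `w` at position `i` is reducible: it is greater than `1`, or it is a `1` at the
beginning of `w`, or it is a `1` at the end of `w` and `w` is not flat. -/
def Reducible (w : PWord) (i : ℕ) : Prop :=
  i < len w ∧ (1 < letter w i ∨ i = 0 ∨ (¬ Flat w ∧ i + 1 = len w))

/-- Reducing the letter at position `i` of a list: a letter `a > 1` becomes `a - 1`, a letter `1` is
removed. -/
def reduceList : List ℕ+ → ℕ → List ℕ+
  | [], _ => []
  | a :: t, 0 => if a = 1 then t else (a - 1) :: t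
  | a :: t, i + 1 => a :: reduceList t i

/-- The word produced from `w` by reducing the letter at position `i`. -/
def reduce (w : PWord) (i : ℕ) : PWord := ⟨reduceList w.letters i⟩

/-- The rank of a word: the sum of its letters (see `rank_nil` and `rank_covBy`). -/
def rank (w : PWord) : ℕ := (w.letters.map PNat.val).sum

/-! ### Chains, labels, minimally skipped intervals -/

/-- `C` lists the words `v₀ = w, v₁, …, vₙ = u` of a maximal chain of the interval `[u, w]`. -/
def IsMaximalChain (u w : PWord) (C : List PWord) : Prop :=
  C.IsChain (fun a b => b ⋖ a) ∧ C.head? = some w ∧ C.getLast? = some u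

/-- `η`, a word over the nonnegative integers, is an expansion of `v`, that is `η ∈ 0* v 0*`. -/
def IsExpansion (η : List ℕ) (v : PWord) : Prop :=
  ∃ a b : ℕ, η = List.replicate a 0 ++ v.letters.map PNat.val ++ List.replicate b 0

/-- The letter at position `i` of an expansion `η` of `v` is reducible: it is greater than `1`, or
it is `1` and the first nonzero letter, or `v` is not flat and it is `1` and the last nonzero
letter. -/
def ExpReducible (η : List ℕ) (v : PWord) (i : ℕ) : Prop :=
  1 < η.getD i 0 ∨
  (η.getD i 0 = 1 ∧ ∀ j < i, η.getD j 0 = 0) ∨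
  (¬ Flat v ∧ η.getD i 0 = 1 ∧ ∀ j > i, η.getD j 0 = 0)

/-- `LabelsFrom η C l`: starting from the expansion `η` of the first word of `C`, the positions
listed in `l` are successively reducible, and reducing them by one leads through expansions
of the words of `C`. -/
inductive LabelsFrom : List ℕ → List PWord → List ℕ → Prop
  | single (η : List ℕ) (v : PWord) : IsExpansion η v → LabelsFrom η [v] []
  | cons (η : List ℕ) (v v' : PWord) (C : List PWord) (i : ℕ) (l : List ℕ) :
      IsExpansion η v → ExpReducible η v i →
      LabelsFrom (η.set i (η.getD i 0 - 1)) (v' :: C) l →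
      LabelsFrom η (v :: v' :: C) (i :: l)

/-- `l = [l₁, …, lₙ]` is the chain id of the chain `C` that descends from `w`. -/
def IsChainId (w : PWord) (C : List PWord) (l : List ℕ) : Prop :=
  LabelsFrom (w.letters.map PNat.val) C l

/-- `C'` comes before `C` in the lexicographic order of chain ids. -/
def ChainLT (w : PWord) (C' C : List PWord) : Prop :=
  ∃ l' l : List ℕ, IsChainId w C' l' ∧ IsChainId w C l ∧ List.Lex (· < ·) l' l

/-- The set of indices `I = {a, …, b}`, with `0 < a ≤ b < n`, is a skipped interval of the maximal
chain `C = [v₀, …, vₙ]` of `[u, w]`: all `v_k` with `k ∉ I` lie in one chain that comes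
before `C`. -/
def IsSkipped (u w : PWord) (C : List PWord) (I : Finset ℕ) : Prop :=
  ∃ a b : ℕ, 0 < a ∧ a ≤ b ∧ b + 1 < C.length ∧ I = Finset.Icc a b ∧
    ∃ C' : List PWord, IsMaximalChain u w C' ∧ ChainLT w C' C ∧
      ∀ k < C.length, k ∉ I → C.getD k nil ∈ C'

/-- Minimally skipped intervals (MSIs): skipped intervals that contain no other one. -/
def IsMSI (u w : PWord) (C : List PWord) (I : Finset ℕ) : Prop :=
  Minimal (IsSkipped u w C) I

open Classical in
/-- The MSIs of `C`, in the order in which they are met along `C`. -/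
noncomputable def msiList (u w : PWord) (C : List PWord) : List (Finset ℕ) :=
  (List.range C.length).flatMap fun a =>
    ((List.range C.length).map fun b => Finset.Icc a b).filter fun I => IsMSI u w C I

/-- The disjoint intervals `J₁, J₂, …` obtained from a list `I₁, I₂, …`: put `J₁ = I₁`, subtract
`J₁` from all other intervals, discard those that then contain another one properly, and continue
with the remaining list. -/
def disjointIntervals : List (Finset ℕ) → List (Finset ℕ)
  | [] => []
  | J :: L =>
    J :: disjointIntervals
      ((L.map fun A => A \ J).filter fun A => ∀ B ∈ L.map (fun A => A \ J), ¬ B ⊂ A)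
termination_by L => L.length
decreasing_by
  simp only [List.length_cons, Nat.lt_succ_iff]
  exact (List.length_filter_le _ _).trans (by simp)

/-- A maximal chain `C = [v₀, …, vₙ]` of `[u, w]` is critical if the intervals `J(C)` obtained from
its MSIs cover `v₁, …, vₙ₋₁`. -/
def IsCritical (u w : PWord) (C : List PWord) : Prop :=
  IsMaximalChain u w C ∧
    {k | ∃ J ∈ disjointIntervals (msiList u w C), k ∈ J} = Set.Ioo 0 (C.length - 1)

/-- For the chain `C = [v₀, …, vₙ]` with chain id `l = [l₁, …, lₙ]`, the word `v_k` is a strong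
descent: `l_k > l_{k+1}` and `v_{k-1} ≠ v_{k+1}11`. -/
def IsStrongDescent (C : List PWord) (l : List ℕ) (k : ℕ) : Prop :=
  l.getD k 0 < l.getD (k - 1) 0 ∧ C.getD (k - 1) nil ≠ ⟨(C.getD (k + 1) nil).letters ++ [1, 1]⟩

/-- All of `v₁, …, vₙ₋₁` are strong descents. -/
def AllStrongDescents (w : PWord) (C : List PWord) : Prop :=
  ∃ l : List ℕ, IsChainId w C l ∧ ∀ k, 0 < k → k + 1 < C.length → IsStrongDescent C l k

/-- The number `t` of critical chains of `[u, w]` that consist entirely of strong descents (there are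
only finitely many maximal chains, since `[u, w]` is finite). -/
noncomputable def strongCount (u w : PWord) : ℕ :=
  Set.ncard {C : List PWord | IsCritical u w C ∧ AllStrongDescents w C}

/-- The term `d(u, w)`, for `u ≤ w`. -/
noncomputable def dTerm (u w : PWord) : ℤ :=
  if 1 < rank w - rank u then (strongCount u w : ℤ) * (-1) ^ (rank w - rank u)
  else (-1) ^ (rank w - rank u)

/-! ### Principal factors, bases, primary prefixes -/

/-- `|u| ≤ |w|` and `u(i) ≤ w(i)` for all positions `i` of `u`. -/
def IsPrefix (u w : PWord) : Prop :=
  len u ≤ len w ∧ ∀ i < len u, letter u i ≤ letter w i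

/-- `|u| ≤ |w|` and `u` is dominated letter by letter by the last `|u|` letters of `w`. -/
def IsSuffix (u w : PWord) : Prop :=
  len u ≤ len w ∧ ∀ i < len u, letter u i ≤ letter w (len w - len u + i)

/-- Outer factors: proper prefixes that are also proper suffixes. -/
def IsOuter (p w : PWord) : Prop := len p < len w ∧ IsPrefix p w ∧ IsSuffix p w

/-- An outer factor that is not contained in a longer outer factor. -/
def IsMaximalOuter (p w : PWord) : Prop :=
  IsOuter p w ∧ ∀ q : PWord, IsOuter q w → len p < len q → ¬ p ≤ q

/-- The principal index of `p` in `w`: the smallest `i` with `w(i) > p(i)` and `w(i)` reducible,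
where `p(i) = 0` for `i` beyond the end of `p`. -/
noncomputable def principalIndex (p w : PWord) : ℕ :=
  sInf {i | letter p i < letter w i ∧ Reducible w i}

/-- Principal factors of `w`: the maximal outer factors `p` that are not flat and that are no longer
suffixes once `w` is reduced at the principal index. -/
def IsPrincipalFactor (p w : PWord) : Prop :=
  IsMaximalOuter p w ∧ ¬ Flat p ∧ ¬ IsSuffix p (reduce w (principalIndex p w))

/-- `v` is a base of `w`. -/
def IsBase (v w : PWord) : Prop :=
  (len v = len w ∨ len v + 1 = len w) ∧
    ∀ j < len w, letter v j = letter w j ∨ letter v j + 1 = letter w j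

/-- The degree of a base `v` of `w`: the number of positions `j` with `v(j) = w(j) - 1`. -/
def degree (v w : PWord) : ℕ :=
  ((Finset.range (len w)).filter fun j => letter v j + 1 = letter w j).card

/-- The smallest position `j` with `v(j) = w(j) - 1`, or the first position beyond the end of `w`
if there is none. -/
noncomputable def firstDrop (v w : PWord) : ℕ :=
  if degree v w = 0 then len w else sInf {j | letter v j + 1 = letter w j}

/-- The pairs `(v, p)` such that `v` is a base of `w` and `p` is a principal factor of `w` of degree
`degree v w` with base `v`: a principal factor of `v` whose principal index is smaller than
every position at which `v` differs from `w`. -/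
def principalPairs (w : PWord) : Set (PWord × PWord) :=
  {q | IsBase q.1 w ∧ IsPrincipalFactor q.2 q.1 ∧ principalIndex q.2 q.1 < firstDrop q.1 w}

/-- `v ∖ 1^m`: the word `v` with `m` letters `1` removed from its end, undefined if `v` does not
end in `m` letters `1`. -/
def stripOnes (v : PWord) (m : ℕ) : Option PWord :=
  if List.replicate m (1 : ℕ+) <:+ v.letters then some ⟨v.letters.take (len v - m)⟩ else none

open Classical in
/-- The primary prefix of a principal factor `p` of `v`: the word `p ∖ 1^m` for the smallest `m > 0`
such that this word is an outer factor of `v'`, where `v'` is `v` reduced at the principal index of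
`p`; undefined if there is no such `m`. -/
noncomputable def primaryPrefix (p v : PWord) : Option PWord :=
  if h : ∃ m, 0 < m ∧ ∃ x, stripOnes p m = some x ∧ IsOuter x (reduce v (principalIndex p v)) then
    stripOnes p (Nat.find h)
  else none

/-- The Möbius function, with the value `0` where the second argument is undefined. -/
noncomputable def muOpt (u : PWord) (v : Option PWord) : ℤ :=
  v.elim 0 fun v => IncidenceAlgebra.mu ℤ u v

/-- `ν(u, v) = ∑_{i ≥ 0} μ(u, v ∖ 1^i)`, with the value `0` where `v` is undefined. The sum stops at
`i = |v|`, since `v ∖ 1^i` is undefined for `i > |v|`. -/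
noncomputable def nu (u : PWord) (v : Option PWord) : ℤ :=
  v.elim 0 fun v => ∑ i ∈ Finset.range (len v + 1), muOpt u (stripOnes v i)

/-! ### Facts that the definitions rely on -/

theorem IsPrefix.le {u w : PWord} (h : IsPrefix u w) : u ≤ w := by
  refine ⟨w.letters.take (len u), (List.take_prefix _ _).isInfix, ?_⟩
  obtain ⟨h1, h2⟩ := h
  unfold len at *
  refine List.forall₂_iff_get.2 ⟨by simp [h1], fun i hi hi' => ?_⟩
  have := h2 i hi
  have hw : i < w.letters.length := hi.trans_le h1
  simpa [letter, List.getD_eq_getElem?_getD, hi, hw] using this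

theorem IsBase.le {v w : PWord} (h : IsBase v w) : v ≤ w := by
  apply IsPrefix.le
  have hl : len v ≤ len w := by have := h.1; omega
  exact ⟨hl, fun i hi => by have := h.2 i (hi.trans_le hl); omega⟩

theorem principalPairs_finite (w : PWord) : (principalPairs w).Finite := by
  refine ((finite_Iic w).prod (finite_Iic w)).subset ?_
  rintro ⟨v, p⟩ ⟨h1, h2, -⟩
  exact ⟨h1.le, (IsPrefix.le h2.1.1.2.1).trans h1.le⟩

/-- The empty word is the least element, and has rank `0`. -/
theorem rank_nil : rank nil = 0 := rfl

theorem exists_pred {b : ℕ+} (hb : b ≠ 1) : ∃ c : ℕ+, c ≤ b ∧ PNat.val c + 1 = PNat.val b := by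
  have h1 : PNat.val b ≠ 1 := fun h => hb (PNat.eq h)
  have h2 : 0 < PNat.val b := b.2
  refine ⟨⟨PNat.val b - 1, by omega⟩, ?_, ?_⟩
  · change PNat.val b - 1 ≤ PNat.val b
    omega
  · change PNat.val b - 1 + 1 = _
    omega

theorem exists_forall₂ {u w : List ℕ+} (h : List.Forall₂ (· ≤ ·) u w) (hne : u ≠ w) :
    ∃ v : List ℕ+, List.Forall₂ (· ≤ ·) u v ∧ List.Forall₂ (· ≤ ·) v w ∧
      (List.map PNat.val v).sum + 1 = (List.map PNat.val w).sum := by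
  induction h with
  | nil => exact absurd rfl hne
  | @cons a b s t hab hst ih =>
    by_cases hab' : a = b
    · subst hab'
      obtain ⟨v, h1, h2, h3⟩ := ih (fun h => hne (by rw [h]))
      exact ⟨a :: v, .cons le_rfl h1, .cons le_rfl h2, by simp; omega⟩
    · have hlt : a < b := lt_of_le_of_ne hab hab'
      obtain ⟨c, hc, hc'⟩ := exists_pred ((show (1 : ℕ+) ≤ a from a.2).trans_lt hlt).ne'
      have hlt' : PNat.val a < PNat.val b := hlt
      refine ⟨c :: t, .cons ?_ hst, .cons hc (List.forall₂_refl _), ?_⟩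
      · change PNat.val a ≤ PNat.val c
        omega
      · simp only [List.map_cons, List.sum_cons]
        omega

theorem exists_rank {u w : PWord} (h : u < w) : ∃ v, u ≤ v ∧ v ≤ w ∧ rank v + 1 = rank w := by
  obtain ⟨⟨s, ⟨a, b, hw⟩, hus⟩, hne⟩ := And.intro h.le h.ne
  obtain ⟨w⟩ := w
  simp only at hw
  cases a with
  | cons x a =>
    subst hw
    by_cases hx : x = 1
    · refine ⟨⟨a ++ s ++ b⟩, ⟨s, ⟨a, b, rfl⟩, hus⟩,
        ⟨a ++ s ++ b, ⟨[x], [], by simp⟩, List.forall₂_refl _⟩, ?_⟩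
      subst hx
      simp [rank]
      omega
    · obtain ⟨c, hc, hc'⟩ := exists_pred hx
      refine ⟨⟨c :: (a ++ s ++ b)⟩, ⟨s, ⟨c :: a, b, rfl⟩, hus⟩, ⟨_, List.infix_rfl, ?_⟩, ?_⟩
      · exact .cons hc (List.forall₂_refl _)
      · simp only [rank, List.cons_append, List.map_cons, List.sum_cons]
        omega
  | nil =>
    rcases List.eq_nil_or_concat b with rfl | ⟨b, x, rfl⟩
    · rw [List.nil_append, List.append_nil] at hw
      subst hw
      obtain ⟨v, h1, h2, h3⟩ := exists_forall₂ hus fun h => hne (PWord.ext h)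
      exact ⟨⟨v⟩, ⟨v, List.infix_rfl, h1⟩, ⟨_, List.infix_rfl, h2⟩, h3⟩
    · subst hw
      by_cases hx : x = 1
      · refine ⟨⟨s ++ b⟩, ⟨s, ⟨[], b, rfl⟩, hus⟩,
          ⟨s ++ b, ⟨[], [x], by simp⟩, List.forall₂_refl _⟩, ?_⟩
        subst hx
        simp [rank]
        omega
      · obtain ⟨c, hc, hc'⟩ := exists_pred hx
        refine ⟨⟨(s ++ b) ++ [c]⟩, ⟨s, ⟨[], b ++ [c], by simp⟩, hus⟩,
          ⟨_, List.infix_rfl, ?_⟩, ?_⟩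
        · have : List.Forall₂ (· ≤ ·) ((s ++ b) ++ [c]) ((s ++ b) ++ [x]) :=
            List.rel_append (List.forall₂_refl _) (.cons hc .nil)
          simpa using this
        · simp [rank]
          omega

/-- `rank` is the rank function of the poset: it is `0` at the
least element and increases by one along each covering relation. -/
theorem rank_covBy {u w : PWord} (h : u ⋖ w) : rank w = rank u + 1 := by
  obtain ⟨v, h1, h2, h3⟩ := exists_rank h.lt
  have hvw : v ≠ w := by rintro rfl; omega
  have : u = v := by
    by_contra hne
    exact h.2 (lt_of_le_of_ne h1 hne) (lt_of_le_of_ne h2 hvw)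
  rw [this, h3]

end PWord

namespace PWord

/-! ### Words as functions -/

/-! Both sides of the formula are compared through their sums over `u ∈ [y, w]`, for every `y ≤ w`;
if all these sums agree, induction downwards from `w` (`eq_zero_of_sum_Icc_eq_zero`) gives equality
for each `u`.

The term `d`: a chain of strong descents reduces letters from right to left, and each of them is
already reducible in `w`. Conversely, every set `S` of reducible positions of `w` gives such a
chain, and the chain is automatically critical, since each inner element alone is skipped
(`isCritical_of_allStrongDescents`). Hence `d(u, w)` is the sum of `(-1)^|S|` over the `S` that turn
`w` into `u` (`dTerm_eq_sum`), and its sum over `[y, w]` is the signed count of the `S` after whose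
lowering `y` still occurs (`sum_dTerm`).

This signed count is evaluated by toggling one position in `S` (`signedCount_toggle`). It vanishes
for flat `y ≠ w`. For nonflat `y ≠ w`, inclusion–exclusion over "occurs at the beginning" and
"occurs later" leaves minus the count of the `S` with both properties, and toggling the excess index
leaves the tight sets (`signedCount_fits_not_flat`).

Tight sets correspond to pairs `(v, p)` of a base and a principal factor with `p = y1^i`, where `i`
is smaller than the number of ones removed for the primary prefix (`signedCount_isTight`). On the
other side, the sum of `ν(u, p) - ν(u, x(p))` over `[y, w]` is the indicator of the same condition
`IsCounted` (`sum_nu_sub_nu`), so everything cancels. -/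

theorem letter_eq_getElem {v : PWord} {i : ℕ} (h : i < v.letters.length) :
    letter v i = (v.letters[i] : ℕ) := by
  simp [letter, List.getD_eq_getElem?_getD, h]

theorem letter_eq_zero {v : PWord} {i : ℕ} (h : len v ≤ i) : letter v i = 0 := by
  have h' : v.letters.length ≤ i := h
  simp [letter, List.getD_eq_getElem?_getD, h']

theorem letter_pos_iff {v : PWord} {i : ℕ} : 0 < letter v i ↔ i < len v := by
  constructor
  · intro h
    by_contra hc
    rw [letter_eq_zero (not_lt.1 hc)] at h
    exact lt_irrefl _ h
  · intro h
    rw [letter_eq_getElem h]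
    exact PNat.pos _

theorem ext_letter {u v : PWord} (h : ∀ i, letter u i = letter v i) : u = v := by
  have hl : len u = len v := by
    apply le_antisymm <;> by_contra hc <;> rw [not_le] at hc
    · have := letter_pos_iff.2 hc
      rw [h, letter_eq_zero le_rfl] at this
      exact lt_irrefl _ this
    · have := letter_pos_iff.2 hc
      rw [← h, letter_eq_zero le_rfl] at this
      exact lt_irrefl _ this
  refine PWord.ext (List.ext_getElem hl fun i h1 h2 => PNat.eq ?_)
  have := h i
  rwa [letter_eq_getElem h1, letter_eq_getElem h2] at this

/-- Every function that is positive exactly on an initial segment lists the letters of a word. -/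
theorem exists_letter_eq {f : ℕ → ℕ} {n : ℕ} (h : ∀ k, 0 < f k ↔ k < n) :
    ∃ v : PWord, ∀ k, letter v k = f k := by
  have hp : ∀ i : Fin n, 0 < f i := fun i => (h i).2 i.2
  refine ⟨⟨List.ofFn fun i : Fin n => Nat.toPNat (f i) (hp i)⟩, fun k => ?_⟩
  by_cases hk : k < n
  · rw [letter_eq_getElem (by rw [List.length_ofFn]; exact hk), List.getElem_ofFn]
    rfl
  · rw [letter_eq_zero (by unfold len; rw [List.length_ofFn]; exact not_lt.1 hk)]
    have := (h k).not.2 hk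
    omega

theorem len_eq_iff {v : PWord} {n : ℕ} : len v = n ↔ ∀ k, 0 < letter v k ↔ k < n := by
  constructor
  · rintro rfl k
    exact letter_pos_iff
  · intro h
    apply le_antisymm <;> by_contra hc <;> rw [not_le] at hc
    · exact lt_irrefl _ ((h n).1 (letter_pos_iff.2 hc))
    · exact lt_irrefl _ (letter_pos_iff.1 ((h _).2 hc))

/-- `y` lies below the function `f` when its first letter is placed at position `a`. -/
def Fits (y : PWord) (f : ℕ → ℕ) (a : ℕ) : Prop := ∀ j < len y, letter y j ≤ f (a + j)

theorem Fits.mono {y : PWord} {f g : ℕ → ℕ} {a : ℕ} (h : Fits y f a) (hfg : ∀ k, f k ≤ g k) :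
    Fits y g a := fun j hj => (h j hj).trans (hfg _)

theorem Fits.add_le_len {y v : PWord} {a : ℕ} (h : Fits y (letter v) a) (hy : 0 < len y) :
    a + len y ≤ len v := by
  have h1 := h (len y - 1) (by omega)
  have h2 : 0 < letter y (len y - 1) := letter_pos_iff.2 (by omega)
  have := letter_pos_iff.1 (h2.trans_le h1)
  omega

theorem le_iff_fits {y v : PWord} : y ≤ v ↔ ∃ a, Fits y (letter v) a := by
  constructor
  · rintro ⟨s, ⟨l, r, hs⟩, h⟩
    refine ⟨l.length, fun j hj => ?_⟩
    have hjs : j < s.length := by rw [← h.length_eq]; exact hj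
    have hv : l.length + j < len v := by
      unfold len; rw [← hs]; simp; omega
    rw [letter_eq_getElem hj, letter_eq_getElem hv]
    have := (List.forall₂_iff_get.1 h).2 j hj hjs
    have e : v.letters[l.length + j]'hv = s[j] := by
      simp [← hs, List.getElem_append_right, List.getElem_append_left, hjs]
    rw [e]
    exact_mod_cast this
  · rintro ⟨a, h⟩
    -- The empty word fits everywhere, even past the end of `v`, so `a` carries no information in
    -- that case.
    by_cases hy : 0 < len y
    · have hl := h.add_le_len hy
      have hl' : a + y.letters.length ≤ v.letters.length := hl
      refine ⟨(v.letters.drop a).take (len y), (List.take_prefix _ _).isInfix.trans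
        (List.drop_suffix _ _).isInfix, List.forall₂_iff_get.2 ⟨?_, fun j h1 h2 => ?_⟩⟩
      · unfold len
        simp
        omega
      · have h3 := h j h1
        have hv : a + j < len v := by
          have : j < len y := h1
          omega
        rw [letter_eq_getElem h1, letter_eq_getElem hv] at h3
        simp only [List.get_eq_getElem, List.getElem_take, List.getElem_drop]
        exact_mod_cast h3
    · have : y.letters = [] := List.eq_nil_of_length_eq_zero (by unfold len at hy; omega)
      exact ⟨[], ⟨[], v.letters, by simp⟩, by rw [this]; exact .nil⟩

theorem flat_iff {v : PWord} : Flat v ↔ ∀ i, letter v i ≤ 1 := by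
  constructor
  · intro h i
    by_cases hi : i < len v
    · have hi' : i < v.letters.length := hi
      rw [letter_eq_getElem hi', h _ (List.getElem_mem hi')]
      rfl
    · rw [letter_eq_zero (not_lt.1 hi)]
      omega
  · intro h a ha
    obtain ⟨i, hi, rfl⟩ := List.getElem_of_mem ha
    have := h i
    rw [letter_eq_getElem hi] at this
    exact le_antisymm (by exact_mod_cast this) one_le

theorem rank_eq_sum {v : PWord} {N : ℕ} (h : len v ≤ N) :
    rank v = ∑ i ∈ Finset.range N, letter v i := by
  have h1 : rank v = ∑ i ∈ Finset.range (len v), letter v i := by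
    unfold rank
    rw [← Fin.sum_univ_getElem, Finset.sum_range]
    refine Fintype.sum_equiv (finCongr (by simp [len])) _ _ fun i => ?_
    have : i.1 < v.letters.length := by simpa using i.2
    simp only [List.getElem_map]
    exact (letter_eq_getElem this).symm
  rw [h1]
  refine Finset.sum_subset (Finset.range_subset_range.2 h) fun i _ hi => ?_
  exact letter_eq_zero (by simpa using hi)

theorem rank_strictMono : StrictMono rank := by
  intro u w h
  obtain ⟨n, hn⟩ : ∃ n, rank w = n := ⟨_, rfl⟩
  induction n using Nat.strong_induction_on generalizing w with
  | _ n ih =>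
    obtain ⟨v, h1, h2, h3⟩ := exists_rank h
    rcases h1.eq_or_lt with rfl | h1
    · omega
    · have := ih (rank v) (by omega) h1 rfl
      omega

theorem covBy_of_rank {u w : PWord} (h : u ≤ w) (hr : rank w = rank u + 1) : u ⋖ w := by
  refine ⟨lt_of_le_of_ne h (by rintro rfl; omega), fun c h1 h2 => ?_⟩
  have := rank_strictMono h1
  have := rank_strictMono h2
  omega

/-! ### Words written with leading zeros -/

/-- `f` is the sequence of letters of `v`, preceded by `A` zeros. -/
def SpreadAt (f : ℕ → ℕ) (v : PWord) (A : ℕ) : Prop :=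
  (∀ j, f (A + j) = letter v j) ∧ ∀ k < A, f k = 0

/-- `f` is the sequence of letters of `v`, preceded by zeros. -/
def Spread (f : ℕ → ℕ) (v : PWord) : Prop := ∃ A, SpreadAt f v A

theorem spread_letter (v : PWord) : Spread (letter v) v := ⟨0, by simp [SpreadAt]⟩

theorem SpreadAt.pos_iff {f : ℕ → ℕ} {v : PWord} {A : ℕ} (h : SpreadAt f v A) (k : ℕ) :
    0 < f k ↔ A ≤ k ∧ k < A + len v := by
  by_cases hk : k < A
  · rw [h.2 k hk]
    omega
  · obtain ⟨j, rfl⟩ := Nat.exists_eq_add_of_le (not_lt.1 hk)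
    rw [h.1, letter_pos_iff]
    omega

theorem spread_of_pos_iff {f : ℕ → ℕ} {A n : ℕ} (h : ∀ k, 0 < f k ↔ A ≤ k ∧ k < A + n) :
    ∃ v, SpreadAt f v A ∧ len v = n := by
  obtain ⟨v, hv⟩ := exists_letter_eq (f := fun k => f (A + k)) (n := n)
    fun k => by rw [h]; omega
  refine ⟨v, ⟨fun j => (hv j).symm, fun k hk => ?_⟩, len_eq_iff.2 fun k => ?_⟩
  · have := (h k).not.2 (by omega)
    omega
  · rw [hv, h]
    omega

theorem SpreadAt.fits {f : ℕ → ℕ} {v : PWord} {A : ℕ} (h : SpreadAt f v A) : Fits v f A :=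
  fun j _ => (h.1 j).ge

/-- Letters are positive, so an occurrence of a nonempty `y` in `f` cannot meet the leading zeros.
Words can therefore be lowered in place, with positions still counted in the original word. -/
theorem Spread.le_iff {f : ℕ → ℕ} {v y : PWord} (h : Spread f v) :
    y ≤ v ↔ ∃ a, Fits y f a := by
  obtain ⟨A, h⟩ := h
  rw [le_iff_fits]
  constructor
  · rintro ⟨a, ha⟩
    refine ⟨A + a, fun j hj => ?_⟩
    rw [add_assoc, h.1]
    exact ha j hj
  · rintro ⟨a, ha⟩
    by_cases hy : 0 < len y
    · have h0 := (h.pos_iff (a + 0)).1 ((letter_pos_iff.2 hy).trans_le (ha 0 hy))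
      obtain ⟨b, rfl⟩ := Nat.exists_eq_add_of_le h0.1
      refine ⟨b, fun j hj => ?_⟩
      have := ha j hj
      rwa [add_assoc, h.1] at this
    · exact ⟨0, fun j hj => by omega⟩

theorem Spread.le {f g : ℕ → ℕ} {u v : PWord} (hf : Spread f u) (hg : Spread g v)
    (h : ∀ k, f k ≤ g k) : u ≤ v := by
  obtain ⟨A, hA⟩ := hf
  exact hg.le_iff.2 ⟨A, hA.fits.mono h⟩

theorem Spread.unique {f : ℕ → ℕ} {u v : PWord} (hu : Spread f u) (hv : Spread f v) : u = v :=
  le_antisymm (hu.le hv fun _ => le_rfl) (hv.le hu fun _ => le_rfl)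

theorem Spread.rank_eq {f : ℕ → ℕ} {v : PWord} (h : Spread f v) :
    ∃ M, ∀ N ≥ M, rank v = ∑ i ∈ Finset.range N, f i := by
  obtain ⟨A, h⟩ := h
  refine ⟨A + len v, fun N hN => ?_⟩
  obtain ⟨n, rfl⟩ := Nat.exists_eq_add_of_le (show A ≤ N by omega)
  rw [Finset.sum_range_add, Finset.sum_eq_zero fun i hi => h.2 i (Finset.mem_range.1 hi), zero_add,
    rank_eq_sum (N := n) (by omega)]
  exact Finset.sum_congr rfl fun i _ => (h.1 i).symm

theorem getD_zeros_append (a b j : ℕ) (l : List ℕ) :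
    (List.replicate a 0 ++ l ++ List.replicate b 0).getD (a + j) 0 = l.getD j 0 := by
  simp only [List.getD_eq_getElem?_getD, List.append_assoc]
  rw [List.getElem?_append_right (by simp), List.length_replicate, Nat.add_sub_cancel_left]
  by_cases hj : j < l.length
  · rw [List.getElem?_append_left hj]
  · rw [List.getElem?_append_right (not_lt.1 hj), List.getElem?_eq_none (not_lt.1 hj),
      List.getElem?_replicate]
    split_ifs <;> simp

theorem getD_zeros_append_of_lt {a k : ℕ} (b : ℕ) (l : List ℕ) (h : k < a) :
    (List.replicate a 0 ++ l ++ List.replicate b 0).getD k 0 = 0 := by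
  simp [List.getD_eq_getElem?_getD, List.getElem?_append_left, h]

theorem isExpansion_iff {η : List ℕ} {v : PWord} :
    IsExpansion η v ↔ Spread (fun k => η.getD k 0) v := by
  constructor
  · rintro ⟨a, b, rfl⟩
    exact ⟨a, fun j => getD_zeros_append a b j _, fun k hk => getD_zeros_append_of_lt b _ hk⟩
  · rintro ⟨A, h⟩
    -- For the empty word the offset `A` may lie beyond the end of `η`; all that matters then is
    -- that `η` consists of zeros.
    by_cases hv : 0 < len v
    · have hl : A + len v ≤ η.length := by
        by_contra hc
        have := (h.pos_iff (A + len v - 1)).2 (by omega)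
        simp only [List.getD_eq_getElem?_getD] at this
        rw [List.getElem?_eq_none (by omega)] at this
        simp at this
      refine ⟨A, η.length - (A + len v), List.ext_getElem ?_ fun k h1 h2 => ?_⟩
      · simp [len] at *
        omega
      · have e : ∀ l : List ℕ, ∀ hk : k < l.length, l[k] = l.getD k 0 := by
          intro l hk
          simp [List.getD_eq_getElem?_getD, hk]
        rw [e, e]
        by_cases hk : k < A
        · rw [getD_zeros_append_of_lt _ _ hk]
          exact h.2 k hk
        · obtain ⟨j, rfl⟩ := Nat.exists_eq_add_of_le (not_lt.1 hk)
          rw [getD_zeros_append]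
          exact h.1 j
    · have hv' : v.letters = [] := List.eq_nil_of_length_eq_zero (by unfold len at hv; omega)
      refine ⟨η.length, 0, ?_⟩
      simp only [hv', List.map_nil, List.replicate_zero, List.append_nil]
      refine List.eq_replicate_iff.2 ⟨rfl, fun b hb => ?_⟩
      obtain ⟨k, hk, rfl⟩ := List.getElem_of_mem hb
      have := (h.pos_iff k).not.2 (by omega)
      simpa [List.getD_eq_getElem?_getD, hk] using this

/-! ### Reducing letters -/

/-- The letter of `f` at position `k` is reducible, `f` being the letters of `v` with zeros around
them. -/
def Step (f : ℕ → ℕ) (v : PWord) (k : ℕ) : Prop :=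
  1 < f k ∨ (f k = 1 ∧ ∀ j < k, f j = 0) ∨ (¬ Flat v ∧ f k = 1 ∧ ∀ j > k, f j = 0)

/-- The function `f` with its value at `k` lowered by one. -/
def dec (f : ℕ → ℕ) (k : ℕ) : ℕ → ℕ := Function.update f k (f k - 1)

theorem dec_self (f : ℕ → ℕ) (k : ℕ) : dec f k k = f k - 1 := by simp [dec]

theorem dec_of_ne (f : ℕ → ℕ) {k j : ℕ} (h : j ≠ k) : dec f k j = f j := by simp [dec, h]

theorem dec_le (f : ℕ → ℕ) (k j : ℕ) : dec f k j ≤ f j := by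
  by_cases h : j = k
  · subst h
    rw [dec_self]
    omega
  · rw [dec_of_ne f h]

theorem getD_set_eq_dec (η : List ℕ) (i : ℕ) :
    (fun k => (η.set i (η.getD i 0 - 1)).getD k 0) = dec (fun k => η.getD k 0) i := by
  funext k
  by_cases h : k = i
  · subst h
    rw [dec_self]
    by_cases hk : k < η.length
    · simp [List.getD_eq_getElem?_getD, hk]
    · simp [List.getD_eq_getElem?_getD, hk]
  · rw [dec_of_ne _ h]
    simp [List.getD_eq_getElem?_getD, List.getElem?_set_ne (Ne.symm h)]

theorem Step.pos {f : ℕ → ℕ} {v : PWord} {k : ℕ} (h : Step f v k) : 0 < f k := by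
  rcases h with h | h | h <;> omega

theorem Spread.rank_dec {f : ℕ → ℕ} {v v' : PWord} {k : ℕ} (hv : Spread f v)
    (hv' : Spread (dec f k) v') (hk : 0 < f k) : rank v = rank v' + 1 := by
  obtain ⟨M, hM⟩ := hv.rank_eq
  obtain ⟨M', hM'⟩ := hv'.rank_eq
  rw [hM (M + M' + k + 1) (by omega), hM' (M + M' + k + 1) (by omega)]
  have : ∀ i, f i = dec f k i + if i = k then 1 else 0 := by
    intro i
    split_ifs with h
    · subst h
      rw [dec_self]
      omega
    · rw [dec_of_ne f h, add_zero]
  rw [Finset.sum_congr rfl fun i _ => this i, Finset.sum_add_distrib, Finset.sum_ite_eq',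
    if_pos (Finset.mem_range.2 (by omega))]

theorem Spread.covBy_dec {f : ℕ → ℕ} {v v' : PWord} {k : ℕ} (hv : Spread f v)
    (hv' : Spread (dec f k) v') (hk : 0 < f k) : v' ⋖ v :=
  covBy_of_rank (hv'.le hv (dec_le f k)) (hv.rank_dec hv' hk)

theorem dec_pos_iff_of_one_lt {f : ℕ → ℕ} {k : ℕ} (h : 1 < f k) (j : ℕ) :
    0 < dec f k j ↔ 0 < f j := by
  by_cases hj : j = k
  · subst hj
    rw [dec_self]
    omega
  · rw [dec_of_ne f hj]

theorem dec_pos_iff_of_eq_one {f : ℕ → ℕ} {k : ℕ} (h : f k = 1) (j : ℕ) :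
    0 < dec f k j ↔ 0 < f j ∧ j ≠ k := by
  by_cases hj : j = k
  · subst hj
    rw [dec_self]
    omega
  · rw [dec_of_ne f hj]
    tauto

theorem SpreadAt.eq_of_first {f : ℕ → ℕ} {v : PWord} {A k : ℕ} (h : SpreadAt f v A) (hk : 0 < f k)
    (h0 : ∀ j < k, f j = 0) : k = A := by
  have h1 := (h.pos_iff k).1 hk
  by_contra hc
  have := h0 A (by omega)
  have := (h.pos_iff A).2 (by omega)
  omega

theorem SpreadAt.eq_of_last {f : ℕ → ℕ} {v : PWord} {A k : ℕ} (h : SpreadAt f v A) (hk : 0 < f k)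
    (h0 : ∀ j > k, f j = 0) : k + 1 = A + len v := by
  have h1 := (h.pos_iff k).1 hk
  by_contra hc
  have := h0 (k + 1) (by omega)
  have := (h.pos_iff (k + 1)).2 (by omega)
  omega

/-- The support of `f` stays an interval: it is unchanged if the letter is greater than `1`, and
loses an end point if a first or last `1` is removed. -/
theorem Step.exists_spread {f : ℕ → ℕ} {v : PWord} {k : ℕ} (hv : Spread f v) (hk : Step f v k) :
    ∃ v', Spread (dec f k) v' := by
  obtain ⟨A, hA⟩ := hv
  have hk0 := (hA.pos_iff k).1 hk.pos
  rcases hk with h | h | h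
  · obtain ⟨v', h', -⟩ := spread_of_pos_iff (f := dec f k) (A := A) (n := len v) fun j => by
      rw [dec_pos_iff_of_one_lt h, hA.pos_iff]
    exact ⟨v', A, h'⟩
  · have := hA.eq_of_first (by omega) h.2
    obtain ⟨v', h', -⟩ := spread_of_pos_iff (f := dec f k) (A := A + 1) (n := len v - 1) fun j => by
      rw [dec_pos_iff_of_eq_one h.1, hA.pos_iff]
      omega
    exact ⟨v', _, h'⟩
  · have := hA.eq_of_last (by omega) h.2.2
    obtain ⟨v', h', -⟩ := spread_of_pos_iff (f := dec f k) (A := A) (n := len v - 1) fun j => by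
      rw [dec_pos_iff_of_eq_one h.2.1, hA.pos_iff]
      omega
    exact ⟨v', _, h'⟩

theorem SpreadAt.flat_iff {f : ℕ → ℕ} {v : PWord} {A : ℕ} (h : SpreadAt f v A) :
    Flat v ↔ ∀ k, f k ≤ 1 := by
  rw [PWord.flat_iff]
  constructor
  · intro hv k
    by_cases hk : k < A
    · rw [h.2 k hk]
      omega
    · obtain ⟨j, rfl⟩ := Nat.exists_eq_add_of_le (not_lt.1 hk)
      rw [h.1]
      exact hv j
  · intro hf i
    rw [← h.1]
    exact hf _

theorem Fits.dec {y : PWord} {f : ℕ → ℕ} {a k : ℕ} (h : Fits y f a)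
    (hk : ∀ j < len y, a + j = k → letter y j < f k) : Fits y (dec f k) a := by
  intro j hj
  by_cases e : a + j = k
  · have := hk j hj e
    rw [e, dec_self]
    omega
  · rw [dec_of_ne f e]
    exact h j hj

/-- Every element covered by `v` arises from `v` by reducing a reducible letter. -/
theorem Spread.exists_step {f : ℕ → ℕ} {v v' : PWord} (hv : Spread f v) (h : v' ⋖ v) :
    ∃ k, Step f v k ∧ Spread (dec f k) v' := by
  -- It is enough to keep an occurrence of `v'` after one reduction: the reduced word lies between
  -- `v'` and `v`, and the covering relation makes it equal to `v'`.
  suffices H : ∃ k a, Step f v k ∧ Fits v' (PWord.dec f k) a by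
    obtain ⟨k, a, hk, ha⟩ := H
    obtain ⟨v'', h''⟩ := hk.exists_spread hv
    have h1 : v' ≤ v'' := h''.le_iff.2 ⟨a, ha⟩
    have h2 : v'' < v := (hv.covBy_dec h'' hk.pos).lt
    refine ⟨k, hk, ?_⟩
    rcases h1.eq_or_lt with rfl | h1
    · exact h''
    · exact absurd h2 (h.2 h1)
  obtain ⟨a, ha⟩ := hv.le_iff.1 h.le
  obtain ⟨A, hA⟩ := hv
  have hn : 0 < len v := by
    by_contra hc
    refine h.ne (ext_letter fun i => ?_)
    rw [letter_eq_zero (v := v) (by omega), letter_eq_zero]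
    have := h.le.len_le
    omega
  have hApos := (hA.pos_iff A).2 (by omega)
  have hLpos := (hA.pos_iff (A + len v - 1)).2 (by omega)
  -- Otherwise the occurrence at `a` covers every letter greater than `1` and is exact there. It
  -- must then miss an end of `v`, since covering both ends would force `v' = v`.
  by_cases h1 : ∃ k, 1 < f k ∧ ∀ j < len v', a + j = k → letter v' j < f k
  · obtain ⟨k, hk1, hk2⟩ := h1
    exact ⟨k, a, .inl hk1, ha.dec hk2⟩
  push Not at h1
  by_cases h2 : ∃ j < len v', a + j = A
  · by_cases h3 : ∃ j < len v', a + j = A + len v - 1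
    · exfalso
      obtain ⟨j2, hj2, e2⟩ := h2
      obtain ⟨j3, hj3, e3⟩ := h3
      have p0 := (hA.pos_iff (a + 0)).1 ((letter_pos_iff.2 (show 0 < len v' by omega)).trans_le
        (ha 0 (by omega)))
      have hl : len v' ≤ len v := h.le.len_le
      obtain rfl : a = A := by omega
      refine h.ne (ext_letter fun i => ?_)
      by_cases hi : i < len v'
      · have q1 := ha i hi
        have q2 := letter_pos_iff.2 hi
        rw [← hA.1 i]
        by_contra hne
        obtain ⟨j, hj, e, h4⟩ := h1 (a + i) (by omega)
        obtain rfl : j = i := by omega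
        omega
      · rw [letter_eq_zero (not_lt.1 hi), letter_eq_zero (by omega)]
    · push Not at h3
      have hL : f (A + len v - 1) = 1 := by
        by_contra hne
        obtain ⟨j, hj, e, -⟩ := h1 _ (show 1 < f (A + len v - 1) by omega)
        exact h3 j hj e
      -- In a flat word a final `1` is not reducible as such; the occurrence is moved one place to
      -- the right, which frees the first letter.
      by_cases hfl : Flat v
      · have hfl' := hA.flat_iff.1 hfl
        refine ⟨A, A + 1, .inr (.inl ⟨le_antisymm (hfl' _) hApos, hA.2⟩), fun j hj => ?_⟩
        obtain ⟨j2, hj2, e2⟩ := h2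
        have p0 := (hA.pos_iff (a + j)).1 ((letter_pos_iff.2 hj).trans_le (ha j hj))
        have := h3 j hj
        have p1 := (ha j hj).trans (hfl' _)
        have p2 := (hA.pos_iff (A + 1 + j)).2 (by
          have := (hA.pos_iff (a + 0)).1 ((letter_pos_iff.2 (show 0 < len v' by omega)).trans_le
            (ha 0 (by omega)))
          omega)
        rw [dec_of_ne f (by omega)]
        omega
      · refine ⟨A + len v - 1, a, .inr (.inr ⟨hfl, hL, fun j hj => ?_⟩),
          ha.dec fun j hj e => absurd e (h3 j hj)⟩
        have := (hA.pos_iff j).not.2 (by omega)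
        omega
  · push Not at h2
    refine ⟨A, a, ?_, ha.dec fun j hj e => absurd e (h2 j hj)⟩
    by_cases h5 : 1 < f A
    · exact .inl h5
    · exact .inr (.inl ⟨by omega, hA.2⟩)

/-- The word determines the position of the reduced letter. -/
theorem Step.unique {f : ℕ → ℕ} {v v' : PWord} {i i' : ℕ} (hv : Spread f v) (hi : Step f v i)
    (hi' : Step f v i') (h : Spread (dec f i) v') (h' : Spread (dec f i') v') : i = i' := by
  wlog hlt : i < i' generalizing i i'
  · by_contra hne
    exact hne (this hi' hi h' h (by omega)).symm
  exfalso
  obtain ⟨A, hA⟩ := hv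
  obtain ⟨B, hB⟩ := h
  obtain ⟨B', hB'⟩ := h'
  have pi := hi.pos
  have pi' := hi'.pos
  have ai := (hA.pos_iff i).1 pi
  have ai' := (hA.pos_iff i').1 pi'
  have key : ∀ k, dec f i (B + k) = dec f i' (B' + k) := fun k => by rw [hB.1, hB'.1]
  by_cases h1 : 1 < f i
  · have e1 : ∀ k, (A ≤ k ∧ k < A + len v) ↔ (B ≤ k ∧ k < B + len v') := fun k => by
      rw [← hA.pos_iff, ← hB.pos_iff, dec_pos_iff_of_one_lt h1]
    -- Two letters greater than `1` leave the same support, so the functions can be compared at `i`.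
    -- In the mixed case the supports have different sizes.
    by_cases h1' : 1 < f i'
    · have e2 : ∀ k, (A ≤ k ∧ k < A + len v) ↔ (B' ≤ k ∧ k < B' + len v') := fun k => by
        rw [← hA.pos_iff, ← hB'.pos_iff, dec_pos_iff_of_one_lt h1']
      have hBB : B = B' := by
        have a1 := e1 A
        have a2 := e2 A
        have a3 := e1 B
        have a4 := e2 B'
        omega
      subst hBB
      have := key (i - B)
      have hBi := (e1 i).1 ai
      rw [Nat.add_sub_cancel' hBi.1, dec_self, dec_of_ne f (by omega)] at this
      omega
    · have e2 : ∀ k, ((A ≤ k ∧ k < A + len v) ∧ k ≠ i') ↔ (B' ≤ k ∧ k < B' + len v') := fun k => by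
        rw [← hA.pos_iff, ← hB'.pos_iff, dec_pos_iff_of_eq_one (by omega)]
      have a1 := e1 A
      have a2 := e1 (A + len v - 1)
      have a3 := e2 B'
      have a4 := e2 (B' + len v' - 1)
      have a5 := e1 B
      have a6 := e1 (B + len v' - 1)
      have a7 := e2 i'
      have a8 := e2 i
      omega
  · have f1 : f i = 1 := by omega
    have e1 : ∀ k, ((A ≤ k ∧ k < A + len v) ∧ k ≠ i) ↔ (B ≤ k ∧ k < B + len v') := fun k => by
      rw [← hA.pos_iff, ← hB.pos_iff, dec_pos_iff_of_eq_one f1]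
    by_cases h1' : 1 < f i'
    · have e2 : ∀ k, (A ≤ k ∧ k < A + len v) ↔ (B' ≤ k ∧ k < B' + len v') := fun k => by
        rw [← hA.pos_iff, ← hB'.pos_iff, dec_pos_iff_of_one_lt h1']
      have a1 := e2 A
      have a2 := e2 (A + len v - 1)
      have a3 := e1 B
      have a4 := e1 (B + len v' - 1)
      have a5 := e2 B'
      have a6 := e2 (B' + len v' - 1)
      have a7 := e1 i
      have a8 := e1 i'
      omega
    · have f1' : f i' = 1 := by omega
      have e2 : ∀ k, ((A ≤ k ∧ k < A + len v) ∧ k ≠ i') ↔ (B' ≤ k ∧ k < B' + len v') := fun k => by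
        rw [← hA.pos_iff, ← hB'.pos_iff, dec_pos_iff_of_eq_one f1']
      have hiA : i = A := by
        rcases hi with h | h | h
        · omega
        · exact hA.eq_of_first pi h.2
        · have := h.2.2 i' hlt
          omega
      obtain ⟨hnf, hL⟩ : ¬ Flat v ∧ i' + 1 = A + len v := by
        rcases hi' with h | h | h
        · omega
        · have := h.2 i hlt
          omega
        · exact ⟨h.1, hA.eq_of_last pi' h.2.2⟩
      have hB1 : B = A + 1 := by
        have a1 := e1 (A + 1)
        have a2 := e1 B
        have a3 := e1 i'
        have a4 := e1 A
        omega
      have hB1' : B' = A := by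
        have a1 := e2 A
        have a2 := e2 B'
        omega
      -- Removing the first `1` and removing the last `1` give the same word, so every letter equals
      -- its right neighbour. Such a word is flat, which is why the last letter of a flat word must
      -- not count as reducible.
      refine hnf (hA.flat_iff.2 fun k => ?_)
      have hstep : ∀ j, A + j < i' → f (A + j + 1) = f (A + j) := fun j hj => by
        have := key j
        rw [hB1, hB1', dec_of_ne f (by omega), dec_of_ne f (by omega)] at this
        rw [← this]
        congr 1
        omega
      have hone : ∀ j, A + j ≤ i' → f (A + j) = 1 := by
        intro j
        induction j with
        | zero => intro; rw [← hiA, add_zero, f1]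
        | succ j ih =>
          intro hj
          rw [← add_assoc, hstep j (by omega), ih (by omega)]
      by_cases hk : A ≤ k ∧ k ≤ i'
      · obtain ⟨j, rfl⟩ := Nat.exists_eq_add_of_le hk.1
        rw [hone j hk.2]
      · have := (hA.pos_iff k).not.2 (by omega)
        omega

/-- The word `y` followed by `i` letters `1`. -/
def withOnes (y : PWord) (i : ℕ) : PWord := ⟨y.letters ++ List.replicate i 1⟩

theorem len_withOnes (y : PWord) (i : ℕ) : len (withOnes y i) = len y + i := by
  simp [withOnes, len]

theorem letter_withOnes (y : PWord) (i k : ℕ) :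
    letter (withOnes y i) k = if k < len y then letter y k else if k < len y + i then 1 else 0 := by
  split_ifs with h1 h2
  · have h1' : k < y.letters.length := h1
    simp [letter, withOnes, List.getD_eq_getElem?_getD, h1', List.getElem?_append_left]
  · obtain ⟨j, rfl⟩ := Nat.exists_eq_add_of_le (not_lt.1 h1)
    have hj : j < i := by omega
    simp only [letter, withOnes, List.getD_eq_getElem?_getD, List.map_append, len]
    rw [List.getElem?_append_right (by simp)]
    simp [hj]
  · exact letter_eq_zero (by rw [len_withOnes]; omega)

/-- A letter that is reducible after a letter to the right of it has been reduced was reducible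
before, unless both letters are ones at the end of the word. -/
theorem Step.of_dec {f : ℕ → ℕ} {v v' : PWord} {i j : ℕ} (hv : Spread f v) (hi : Step f v i)
    (hj : Step (dec f i) v' j) (hji : j < i) :
    Step f v j ∨ i = j + 1 ∧ f j = 1 ∧ f i = 1 ∧ ∀ k > i, f k = 0 := by
  obtain ⟨A, hA⟩ := hv
  unfold Step at hj
  rw [dec_of_ne f hji.ne] at hj
  rcases hj with h | h | h
  · exact .inl (.inl h)
  · refine .inl (.inr (.inl ⟨h.1, fun k hk => ?_⟩))
    rw [← h.2 k hk, dec_of_ne f (by omega)]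
  · right
    have hi0 := h.2.2 i hji
    rw [dec_self] at hi0
    have pi := (hA.pos_iff i).1 hi.pos
    have pj := (hA.pos_iff j).1 (by omega)
    have pi' := hi.pos
    refine ⟨?_, h.2.1, by omega, fun k hk => ?_⟩
    · by_contra hne
      have h3 := h.2.2 (j + 1) (by omega)
      rw [dec_of_ne f (by omega)] at h3
      have := (hA.pos_iff (j + 1)).2 (by omega)
      omega
    · rw [← h.2.2 k (by omega), dec_of_ne f (by omega)]

/-- Identifies the exceptional case of `Step.of_dec` with the case excluded by the second condition
on strong descents. -/
theorem eq_append_ones {f : ℕ → ℕ} {v x : PWord} {j : ℕ} (hv : Spread f v)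
    (hx : Spread (dec (dec f (j + 1)) j) x) (hj : f j = 1) (hj' : f (j + 1) = 1)
    (h0 : ∀ k > j + 1, f k = 0) : v = ⟨x.letters ++ [1, 1]⟩ := by
  obtain ⟨A, hA⟩ := hv
  have hL := hA.eq_of_last (k := j + 1) (by omega) h0
  have pj := (hA.pos_iff j).1 (by omega)
  obtain ⟨x', hx', hlen⟩ := spread_of_pos_iff (f := dec (dec f (j + 1)) j) (A := A)
    (n := len v - 2) fun k => by
      rw [dec_pos_iff_of_eq_one (by rw [dec_of_ne f (by omega), hj]), dec_pos_iff_of_eq_one hj',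
        hA.pos_iff]
      omega
  obtain rfl : x' = x := Spread.unique ⟨A, hx'⟩ hx
  refine ext_letter fun k => ?_
  change letter v k = letter (withOnes x' 2) k
  rw [letter_withOnes, ← hA.1]
  split_ifs with h1 h2
  · rw [← hx'.1, dec_of_ne _ (by omega), dec_of_ne _ (by omega)]
  · by_cases e : A + k = j
    · rw [e, hj]
    · rw [show A + k = j + 1 by omega, hj']
  · exact h0 _ (by omega)

/-- If `v` were `x11`, both reductions would have to remove a letter, hence the first and the last
letter of a nonflat `v`. But then `x` is both `v` without its two ends and `v` without its last two
letters, so adjacent letters agree and `v` is flat. -/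
theorem ne_append_ones {f : ℕ → ℕ} {v x : PWord} {i j : ℕ} (hv : Spread f v)
    (hi : Step f v i) (hj : Step f v j) (hji : j < i)
    (hx : Spread (dec (dec f i) j) x) : v ≠ ⟨x.letters ++ [1, 1]⟩ := by
  intro hvx
  have hlet := fun k => letter_withOnes x 2 k
  rw [show withOnes x 2 = v from hvx.symm] at hlet
  obtain ⟨A, hA⟩ := hv
  obtain ⟨B, hB⟩ := hx
  have hlen : len v = len x + 2 := by rw [hvx]; simp [len]
  have pi := hi.pos
  have pj := hj.pos
  have ai := (hA.pos_iff i).1 pi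
  have aj := (hA.pos_iff j).1 pj
  have hpos : ∀ k, (B ≤ k ∧ k < B + len x) → (A ≤ k ∧ k < A + len v) := fun k hk => by
    rw [← hA.pos_iff]
    exact ((hB.pos_iff k).2 hk).trans_le ((dec_le _ _ _).trans (dec_le _ _ _))
  have hpos' : ∀ k, k ≠ i → k ≠ j → (A ≤ k ∧ k < A + len v) → (B ≤ k ∧ k < B + len x) :=
    fun k h1 h2 hk => by
      rw [← hB.pos_iff, dec_of_ne _ h2, dec_of_ne _ h1]
      exact (hA.pos_iff k).2 hk
  have hfj : (1 < f j ∨ f i ≠ 1) → False := by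
    intro hc
    have : ∃ k, (k = i ∨ k = j) ∧ (B ≤ k ∧ k < B + len x) := by
      rcases hc with hc | hc
      · refine ⟨j, .inr rfl, (hB.pos_iff j).1 ?_⟩
        rw [dec_self, dec_of_ne f (by omega)]
        omega
      · refine ⟨i, .inl rfl, (hB.pos_iff i).1 ?_⟩
        rw [dec_of_ne _ (by omega), dec_self]
        omega
    obtain ⟨k, hk, hk'⟩ := this
    have b1 := hpos B (by omega)
    have b2 := hpos (B + len x - 1) (by omega)
    have b3 := hpos' A
    have b4 := hpos' (A + 1)
    have b5 := hpos' (A + len v - 1)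
    have b6 := hpos' (A + len v - 2)
    omega
  have fj : f j = 1 := by by_contra h; exact hfj (by omega)
  have fi : f i = 1 := by by_contra h; exact hfj (by omega)
  have hjA : j = A := by
    rcases hj with h | h | h
    · omega
    · exact hA.eq_of_first pj h.2
    · have := h.2.2 i hji
      omega
  have hnf : ¬ Flat v := by
    rcases hi with h | h | h
    · omega
    · have := h.2 j hji
      omega
    · exact h.1
  have hiL : i + 1 = A + len v := by
    rcases hi with h | h | h
    · omega
    · have := h.2 j hji
      omega
    · exact hA.eq_of_last pi h.2.2
  -- The first letter of `v` has been removed, so a nonempty `x` starts one place later.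
  have hBA : 0 < len x → B = A + 1 := by
    intro h0
    have b1 := hpos B (by omega)
    have b2 := hpos (B + len x - 1) (by omega)
    have b3 := hpos' (A + 1)
    have b4 := fun h => (hB.pos_iff j).2 h
    rw [dec_self, dec_of_ne f (by omega)] at b4
    omega
  refine hnf (PWord.flat_iff.2 fun k => ?_)
  have hone : ∀ k, k < len x → letter x k = 1 := by
    intro k
    induction k with
    | zero =>
      intro hk
      have := hlet 0
      rw [if_pos hk, ← hA.1, add_zero, ← hjA, fj] at this
      exact this.symm
    | succ k ih =>
      intro hk
      have h1 := hlet (k + 1)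
      rw [if_pos hk, ← hA.1] at h1
      have h2 := ih (by omega)
      rw [← hB.1, hBA (by omega), dec_of_ne _ (by omega), dec_of_ne _ (by omega)] at h2
      rw [← h1, ← h2]
      congr 1
      omega
  rw [hlet k]
  split_ifs with h1 h2
  · exact (hone k h1).le
  · exact le_rfl
  · omega

/-! ### Chain ids -/

theorem expReducible_iff {η : List ℕ} {v : PWord} {i : ℕ} :
    ExpReducible η v i ↔ Step (fun k => η.getD k 0) v i := Iff.rfl

theorem labelsFrom_cons_iff {η : List ℕ} {v v' : PWord} {C : List PWord} {l : List ℕ} :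
    LabelsFrom η (v :: v' :: C) l ↔ ∃ i l', l = i :: l' ∧ IsExpansion η v ∧ ExpReducible η v i ∧
      LabelsFrom (η.set i (η.getD i 0 - 1)) (v' :: C) l' := by
  constructor
  · rintro (_ | ⟨_, _, _, _, i, l', h1, h2, h3⟩)
    exact ⟨i, l', rfl, h1, h2, h3⟩
  · rintro ⟨i, l', rfl, h1, h2, h3⟩
    exact .cons _ _ _ _ _ _ h1 h2 h3

theorem labelsFrom_single_iff {η : List ℕ} {v : PWord} {l : List ℕ} :
    LabelsFrom η [v] l ↔ l = [] ∧ IsExpansion η v := by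
  constructor
  · rintro (⟨_, _, h⟩ | _)
    exact ⟨rfl, h⟩
  · rintro ⟨rfl, h⟩
    exact .single _ _ h

theorem LabelsFrom.isExpansion {η : List ℕ} {v : PWord} {C : List PWord} {l : List ℕ}
    (h : LabelsFrom η (v :: C) l) : IsExpansion η v := by
  cases h <;> assumption

theorem isExpansion_set_iff {η : List ℕ} {v : PWord} {i : ℕ} :
    IsExpansion (η.set i (η.getD i 0 - 1)) v ↔ Spread (dec (fun k => η.getD k 0) i) v := by
  rw [isExpansion_iff, getD_set_eq_dec]

theorem exists_labelsFrom {η : List ℕ} {v : PWord} {C : List PWord} (h : IsExpansion η v)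
    (hC : (v :: C).IsChain (fun a b => b ⋖ a)) : ∃ l, LabelsFrom η (v :: C) l := by
  induction C generalizing η v with
  | nil => exact ⟨[], .single _ _ h⟩
  | cons v' C ih =>
    rw [List.isChain_cons_cons] at hC
    obtain ⟨k, hk, hk'⟩ := (isExpansion_iff.1 h).exists_step hC.1
    obtain ⟨l, hl⟩ := ih (isExpansion_set_iff.2 hk') hC.2
    exact ⟨k :: l, .cons _ _ _ _ _ _ h hk hl⟩

/-- The lexicographic order is well defined because consecutive words determine the reduced position
(`Step.unique`). -/
theorem LabelsFrom.unique {η : List ℕ} {C : List PWord} {l l' : List ℕ}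
    (h : LabelsFrom η C l) (h' : LabelsFrom η C l') : l = l' := by
  induction h generalizing l' with
  | single η v h => exact (labelsFrom_single_iff.1 h').1.symm
  | cons η v v' C i l h1 h2 h3 ih =>
    obtain ⟨i', l₁, rfl, -, h5, h6⟩ := labelsFrom_cons_iff.1 h'
    obtain rfl := Step.unique (isExpansion_iff.1 h1) h2 h5 (isExpansion_set_iff.1 h3.isExpansion)
      (isExpansion_set_iff.1 h6.isExpansion)
    rw [ih h6]

theorem LabelsFrom.chain_unique {η : List ℕ} {C C' : List PWord} {l : List ℕ}
    (h : LabelsFrom η C l) (h' : LabelsFrom η C' l) : C = C' := by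
  induction h generalizing C' with
  | single η v h =>
    cases h' with
    | single _ v' h' => rw [(isExpansion_iff.1 h).unique (isExpansion_iff.1 h')]
  | cons η v v' C i l h1 h2 h3 ih =>
    cases h' with
    | cons _ v₁ v₁' C₁ _ _ h4 h5 h6 =>
      rw [ih h6, (isExpansion_iff.1 h1).unique (isExpansion_iff.1 h4)]

theorem LabelsFrom.isChain {η : List ℕ} {C : List PWord} {l : List ℕ} (h : LabelsFrom η C l) :
    C.IsChain (fun a b => b ⋖ a) := by
  induction h with
  | single => exact .singleton _
  | cons η v v' C i l h1 h2 h3 ih =>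
    rw [List.isChain_cons_cons]
    exact ⟨(isExpansion_iff.1 h1).covBy_dec (isExpansion_set_iff.1 h3.isExpansion)
      (expReducible_iff.1 h2).pos, ih⟩

/-! ### Chains of strong descents are critical -/

/-- At a strong descent the chain can be rerouted through another word, which gives a smaller chain
id. -/
theorem LabelsFrom.exists_swap {η : List ℕ} {C : List PWord} {l : List ℕ}
    (h : LabelsFrom η C l) (k : ℕ) (hk : k + 2 < C.length) (hl : l.getD (k + 1) 0 < l.getD k 0)
    (hne : C.getD k nil ≠ ⟨(C.getD (k + 2) nil).letters ++ [1, 1]⟩) :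
    ∃ x l', LabelsFrom η (C.set (k + 1) x) l' ∧ List.Lex (· < ·) l' l := by
  induction h generalizing k with
  | single => simp at hk
  | cons η v v' C i l h1 h2 h3 ih =>
    cases k with
    | succ k =>
      obtain ⟨x, l', hx, hlex⟩ := ih k (by simpa using hk) (by simpa using hl) (by simpa using hne)
      refine ⟨x, i :: l', ?_, .cons hlex⟩
      simp only [List.set_cons_succ] at hx ⊢
      exact .cons _ _ _ _ _ _ h1 h2 hx
    | zero =>
      cases C with
      | nil => simp at hk
      | cons v₂ C =>
        obtain ⟨j, l, rfl, h4, h5, h6⟩ := labelsFrom_cons_iff.1 h3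
        have hji : j < i := by simpa using hl
        have hne' : v ≠ ⟨v₂.letters ++ [1, 1]⟩ := by simpa using hne
        have s1 := isExpansion_iff.1 h1
        have s3 := isExpansion_set_iff.1 h6.isExpansion
        rw [expReducible_iff] at h2 h5
        rw [getD_set_eq_dec] at h5 s3
        -- The smaller position `j` can be reduced first; the only obstruction is the pair of final
        -- ones excluded by `hne`.
        have hj : Step (fun k => η.getD k 0) v j := by
          rcases Step.of_dec s1 h2 h5 hji with h | ⟨rfl, h⟩
          · exact h
          · exact absurd (eq_append_ones s1 s3 h.1 h.2.1 h.2.2) hne'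
        obtain ⟨x, hx⟩ := hj.exists_spread s1
        have hxv := s1.covBy_dec hx hj.pos
        have hv₂ : v₂ ≤ x := s3.le hx fun k => by
          by_cases e : k = j
          · subst e
            rw [dec_self, dec_self, dec_of_ne _ hji.ne]
          · rw [dec_of_ne _ e, dec_of_ne _ e]
            exact dec_le _ _ _
        have c := h3.isChain
        rw [List.isChain_cons_cons] at c
        have hvv := s1.covBy_dec (isExpansion_set_iff.1 h4) h2.pos
        have hxv₂ : v₂ ⋖ x := covBy_of_rank hv₂ (by
          have := rank_covBy hxv
          have := rank_covBy c.1
          have := rank_covBy hvv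
          omega)
        obtain ⟨l', hl'⟩ := exists_labelsFrom (C := v₂ :: C) (isExpansion_set_iff.2 hx)
          (List.isChain_cons_cons.2 ⟨hxv₂, c.2⟩)
        -- The labels after `j` may change, but `j < i` already decides the lexicographic
        -- comparison.
        exact ⟨x, j :: l', .cons _ _ _ _ _ _ h1 hj hl', .rel hji⟩

theorem IsSkipped.exists_singleton {u w : PWord} {C : List PWord} {I : Finset ℕ}
    (h : IsSkipped u w C I) : ∃ k, 0 < k ∧ k + 1 < C.length ∧ {k} ⊆ I := by
  obtain ⟨a, b, h1, h2, h3, rfl, -⟩ := h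
  exact ⟨a, h1, by omega, by simp [h2]⟩

theorem isSkipped_singleton {u w : PWord} {C : List PWord} {l : List ℕ}
    (hC : IsMaximalChain u w C) (hl : IsChainId w C l) {k : ℕ} (hk : 0 < k)
    (hk' : k + 1 < C.length) (h : IsStrongDescent C l k) : IsSkipped u w C {k} := by
  obtain ⟨k, rfl⟩ := Nat.exists_eq_add_of_lt hk
  simp only [zero_add] at *
  obtain ⟨x, l', hx, hlex⟩ := LabelsFrom.exists_swap hl k (by omega) h.1 h.2
  refine ⟨k + 1, k + 1, hk, le_rfl, hk', by simp, C.set (k + 1) x, ⟨hx.isChain, ?_, ?_⟩,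
    ⟨l', l, hx, hl, hlex⟩, fun j hj hjk => ?_⟩
  · rw [← hC.2.1]
    cases C <;> simp
  · rw [← hC.2.2, List.getLast?_eq_getElem?, List.getLast?_eq_getElem?, List.length_set,
      List.getElem?_set_ne (by omega)]
  · have hne : k + 1 ≠ j := fun e => hjk (by simp [e])
    rw [List.getD_eq_getElem?_getD, List.getElem?_eq_getElem hj, Option.getD_some]
    rw [List.mem_iff_getElem]
    exact ⟨j, by simpa using hj, by simp [List.getElem_set_ne hne]⟩

/-- Distinct singletons are disjoint, so subtraction changes none of them, and none properly
contains another. -/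
theorem disjointIntervals_singletons (r : List ℕ) (hr : r.Nodup) :
    disjointIntervals (r.map fun k => ({k} : Finset ℕ)) = r.map fun k => ({k} : Finset ℕ) := by
  induction r with
  | nil => simp [disjointIntervals]
  | cons k r ih =>
    rw [List.nodup_cons] at hr
    rw [List.map_cons, disjointIntervals]
    have e : (r.map fun k => ({k} : Finset ℕ)).map (fun A => A \ {k}) =
        r.map fun k => ({k} : Finset ℕ) := by
      rw [List.map_map]
      refine List.map_congr_left fun j hj => ?_
      have : j ≠ k := by
        rintro rfl
        exact hr.1 hj
      simp [this]
    rw [e, List.filter_eq_self.2, ih hr.2]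
    intro A hA
    obtain ⟨a, -, rfl⟩ := List.mem_map.1 hA
    simp only [decide_eq_true_eq]
    intro B hB
    obtain ⟨b, -, rfl⟩ := List.mem_map.1 hB
    intro hs
    have := Finset.card_lt_card hs
    simp at this

/-- Rerouting at each strong descent makes every inner singleton a skipped interval. The MSIs are
then exactly these singletons, and they cover the inside of the chain. Criticality is thus no extra
condition in `strongCount`. -/
theorem isCritical_of_allStrongDescents {u w : PWord} {C : List PWord}
    (hC : IsMaximalChain u w C) (h : AllStrongDescents w C) : IsCritical u w C := by
  classical
  refine ⟨hC, ?_⟩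
  obtain ⟨l, hl, hs⟩ := h
  have hsk : ∀ k, 0 < k → k + 1 < C.length → IsSkipped u w C {k} := fun k h1 h2 =>
    isSkipped_singleton hC hl h1 h2 (hs k h1 h2)
  have hmsi : ∀ I, IsMSI u w C I ↔ ∃ k, (0 < k ∧ k + 1 < C.length) ∧ I = {k} := by
    intro I
    constructor
    · intro hI
      obtain ⟨k, h1, h2, h3⟩ := hI.prop.exists_singleton
      exact ⟨k, ⟨h1, h2⟩, hI.eq_of_ge (hsk k h1 h2) h3⟩
    · rintro ⟨k, ⟨h1, h2⟩, rfl⟩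
      refine ⟨hsk k h1 h2, fun I hI hIk => ?_⟩
      obtain ⟨a, b, -, hab, -, rfl, -⟩ := hI
      have : a ∈ Finset.Icc a b := by simp [hab]
      have e : a = k := by simpa using hIk this
      subst e
      simpa using hab
  have hlist : msiList u w C =
      ((List.range C.length).filter fun k => 0 < k ∧ k + 1 < C.length).map
        fun k => ({k} : Finset ℕ) := by
    -- The outer range is generalized to a list `r` for the induction, while the inner range stays
    -- fixed.
    have aux : ∀ r : List ℕ, (∀ a ∈ r, a < C.length) → (r.flatMap fun a =>
        ((List.range C.length).map fun b => Finset.Icc a b).filter fun I => IsMSI u w C I) =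
        (r.filter fun k => 0 < k ∧ k + 1 < C.length).map fun k => ({k} : Finset ℕ) := by
      intro r hr
      induction r with
      | nil => rfl
      | cons a r ih =>
        rw [List.flatMap_cons, ih fun b hb => hr b (List.mem_cons_of_mem _ hb)]
        have ha := hr a List.mem_cons_self
        -- An interval from `a` to `b` is a singleton only for `b = a`, so each starting point
        -- contributes at most one MSI.
        have hiff : ∀ b, IsMSI u w C (Finset.Icc a b) ↔ b = a ∧ 0 < a ∧ a + 1 < C.length := by
          intro b
          rw [hmsi]
          constructor
          · rintro ⟨k, hk, he⟩
            have hab : a ≤ b := by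
              by_contra hc
              rw [Finset.Icc_eq_empty hc] at he
              exact (Finset.singleton_ne_empty k he.symm).elim
            have h1 : a ∈ Finset.Icc a b := by simp [hab]
            have h2 : b ∈ Finset.Icc a b := by simp [hab]
            rw [he, Finset.mem_singleton] at h1 h2
            omega
          · rintro ⟨rfl, hb⟩
            exact ⟨b, hb, by simp⟩
        rw [List.filter_map]
        have hfun : ((fun I => decide (IsMSI u w C I)) ∘ fun b => Finset.Icc a b) =
            fun b => decide (b = a) && decide (0 < a ∧ a + 1 < C.length) := by
          funext b
          simp [hiff b]
        rw [hfun]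
        by_cases hc : 0 < a ∧ a + 1 < C.length
        · rw [List.filter_cons_of_pos (by simpa using hc)]
          simp only [hc, and_self, decide_true, Bool.and_true]
          have hone : (List.range C.length).filter (fun b => decide (b = a)) = [a] := by
            refine List.perm_singleton.1 ((List.perm_ext_iff_of_nodup
              (List.nodup_range.filter _) (List.nodup_singleton a)).2 fun b => ?_)
            simp only [List.mem_filter, List.mem_range, decide_eq_true_eq, List.mem_singleton]
            exact ⟨fun h => h.2, fun h => ⟨h ▸ ha, h⟩⟩
          rw [hone]
          simp
        · rw [List.filter_cons_of_neg (by simpa using hc)]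
          simp [hc]
    exact aux _ fun a ha => by simpa using ha
  rw [hlist, disjointIntervals_singletons _ (List.nodup_range.filter _)]
  ext k
  simp only [List.mem_map, List.mem_filter, List.mem_range, decide_eq_true_eq, Set.mem_ofPred_eq,
    Set.mem_Ioo]
  constructor
  · rintro ⟨J, ⟨a, ⟨-, ha⟩, rfl⟩, hk⟩
    rw [Finset.mem_singleton] at hk
    omega
  · intro hk
    exact ⟨{k}, ⟨k, by omega, rfl⟩, by simp⟩

/-! ### The term `d(u, w)` as a sum over sets of positions -/

/-- The letters of `w`, those at positions in `S` lowered by one. -/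
def drop (w : PWord) (S : Finset ℕ) (k : ℕ) : ℕ := letter w k - if k ∈ S then 1 else 0

open Classical in
/-- The positions of the reducible letters of `w`. -/
noncomputable def reducibles (w : PWord) : Finset ℕ :=
  (Finset.range (len w)).filter fun k => Step (letter w) w k

theorem mem_reducibles {w : PWord} {k : ℕ} : k ∈ reducibles w ↔ Step (letter w) w k := by
  classical
  simp only [reducibles, Finset.mem_filter, Finset.mem_range, and_iff_right_iff_imp]
  exact fun h => letter_pos_iff.1 h.pos

/-- `f` lowered by one at the positions that occur in `l`. -/
def decs (f : ℕ → ℕ) (l : List ℕ) : ℕ → ℕ := l.foldl dec f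

theorem decs_cons (f : ℕ → ℕ) (i : ℕ) (l : List ℕ) : decs f (i :: l) = decs (dec f i) l := rfl

theorem decs_eq (f : ℕ → ℕ) (l : List ℕ) (hl : l.Nodup) (k : ℕ) :
    decs f l k = f k - if k ∈ l then 1 else 0 := by
  induction l generalizing f with
  | nil => simp [decs]
  | cons i l ih =>
    rw [List.nodup_cons] at hl
    rw [decs_cons, ih _ hl.2]
    by_cases h : k = i
    · subst h
      simp [hl.1, dec_self]
    · rw [dec_of_ne f h]
      simp [h]

theorem LabelsFrom.spread_getLast {η : List ℕ} {C : List PWord} {l : List ℕ} {u : PWord}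
    (h : LabelsFrom η C l) (hu : C.getLast? = some u) :
    Spread (decs (fun k => η.getD k 0) l) u := by
  induction h with
  | single η v h =>
    simp only [List.getLast?_singleton, Option.some.injEq] at hu
    subst hu
    exact isExpansion_iff.1 h
  | cons η v v' C i l h1 h2 h3 ih =>
    rw [List.getLast?_cons_cons] at hu
    rw [decs_cons, ← getD_set_eq_dec]
    exact ih hu

/-- Reducibility is pulled back along the chain by `Step.of_dec`, so a chain of strong descents is
encoded by a set of positions reducible at its top. -/
theorem LabelsFrom.step_of_strong {η : List ℕ} {v : PWord} {C : List PWord} {l : List ℕ}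
    (h : LabelsFrom η (v :: C) l)
    (hs : ∀ k, 0 < k → k + 1 < (v :: C).length → IsStrongDescent (v :: C) l k) :
    l.IsChain (· > ·) ∧ ∀ j ∈ l, Step (fun k => η.getD k 0) v j := by
  induction C generalizing η v l with
  | nil =>
    rw [(labelsFrom_single_iff.1 h).1]
    simp
  | cons v' C ih =>
    obtain ⟨i, l, rfl, h1, h2, h3⟩ := labelsFrom_cons_iff.1 h
    obtain ⟨hc, hst⟩ := ih h3 fun k hk hk' => by
      obtain ⟨k, rfl⟩ := Nat.exists_eq_add_of_lt hk
      have := hs (k + 2) (by omega) (by simp at hk' ⊢; omega)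
      simpa [IsStrongDescent] using this
    cases C with
    | nil =>
      obtain ⟨rfl, -⟩ := labelsFrom_single_iff.1 h3
      refine ⟨.singleton _, fun m hm => ?_⟩
      rw [List.mem_singleton.1 hm]
      exact h2
    | cons v₂ C =>
      obtain ⟨j, l, rfl, h4, h5, h6⟩ := labelsFrom_cons_iff.1 h3
      have h7 := hs 1 (by omega) (by simp)
      simp only [IsStrongDescent, List.getD_cons_zero, List.getD_cons_succ, Nat.sub_self] at h7
      refine ⟨List.isChain_cons_cons.2 ⟨h7.1, hc⟩, ?_⟩
      intro m hm
      rw [List.mem_cons] at hm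
      rcases hm with rfl | hm
      · exact h2
      have s1 := isExpansion_iff.1 h1
      have s3 := isExpansion_set_iff.1 h6.isExpansion
      have hst' := hst m hm
      rw [getD_set_eq_dec] at hst' s3
      have hp := List.isChain_iff_pairwise.1 hc
      have hmj : m ≤ j := by
        rcases List.mem_cons.1 hm with rfl | hm
        · exact le_rfl
        · exact (List.rel_of_pairwise_cons hp hm).le
      have hmi : m < i := by have := h7.1; omega
      rcases Step.of_dec s1 h2 hst' hmi with h | ⟨rfl, h⟩
      · exact h
      -- Here `m ≤ j < i = m + 1`: the exceptional position is the one reduced immediately after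
      -- `i`, where the strong descent condition applies.
      · obtain rfl : j = m := by have := h7.1; omega
        exact absurd (eq_append_ones s1 s3 h.1 h.2.1 h.2.2) h7.2

/-- Reducing from right to left does not spoil the remaining positions: a letter to the left keeps
its value and everything before it. -/
theorem exists_chain_of_steps {η : List ℕ} {v : PWord} (h : IsExpansion η v) (l : List ℕ)
    (hl : l.IsChain (· > ·)) (hst : ∀ j ∈ l, Step (fun k => η.getD k 0) v j) :
    ∃ C, LabelsFrom η (v :: C) l ∧
      ∀ k, 0 < k → k + 1 < (v :: C).length → IsStrongDescent (v :: C) l k := by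
  induction l generalizing η v with
  | nil => exact ⟨[], .single _ _ h, by simp⟩
  | cons i l ih =>
    have s := isExpansion_iff.1 h
    have hi := hst i List.mem_cons_self
    obtain ⟨v', hv'⟩ := hi.exists_spread s
    have hlt : ∀ j ∈ l, j < i := fun j hj =>
      List.rel_of_pairwise_cons (List.isChain_iff_pairwise.1 hl) hj
    obtain ⟨C, hC, hs⟩ := ih (isExpansion_set_iff.2 hv') hl.tail fun j hj => by
      have hji := hlt j hj
      have hj' := hst j (List.mem_cons_of_mem _ hj)
      rw [getD_set_eq_dec]
      unfold Step at hj' ⊢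
      rw [dec_of_ne _ hji.ne]
      rcases hj' with h | h | h
      · exact .inl h
      · refine .inr (.inl ⟨h.1, fun k hk => ?_⟩)
        rw [dec_of_ne _ (by omega)]
        exact h.2 k hk
      -- A position left of `i` cannot be that of the last nonzero letter.
      · exact absurd (h.2.2 i hji) hi.pos.ne'
    refine ⟨v' :: C, .cons _ _ _ _ _ _ h hi hC, fun k hk hk' => ?_⟩
    obtain ⟨k, rfl⟩ := Nat.exists_eq_add_of_lt hk
    simp only [zero_add] at *
    cases k with
    | succ k =>
      have := hs (k + 1) (by omega) (by simp at hk' ⊢; omega)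
      simpa [IsStrongDescent] using this
    | zero =>
      cases C with
      | nil => simp at hk'
      | cons v₂ C =>
        obtain ⟨j, l, rfl, h4, h5, h6⟩ := labelsFrom_cons_iff.1 hC
        have s3 := isExpansion_set_iff.1 h6.isExpansion
        rw [getD_set_eq_dec] at s3
        have hji := hlt j List.mem_cons_self
        refine ⟨by simpa using hji, ?_⟩
        simpa using ne_append_ones s hi (hst j (by simp)) hji s3

theorem drop_empty (w : PWord) : drop w ∅ = letter w := by
  funext k
  simp [drop]

theorem drop_singleton (w : PWord) (k : ℕ) : drop w {k} = dec (letter w) k := by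
  funext j
  by_cases h : j = k
  · subst h
    simp [drop, dec_self]
  · simp [drop, dec_of_ne _ h, h]

theorem drop_le (w : PWord) (S : Finset ℕ) (k : ℕ) : drop w S k ≤ letter w k := Nat.sub_le _ _

theorem decs_sort (w : PWord) (S : Finset ℕ) : decs (letter w) (S.sort (· ≥ ·)) = drop w S := by
  funext k
  rw [decs_eq _ _ (Finset.sort_nodup _ _)]
  simp [drop]

theorem exists_chain_of_subset {w : PWord} {S : Finset ℕ} (hS : S ⊆ reducibles w) :
    ∃ u C, Spread (drop w S) u ∧ IsMaximalChain u w C ∧ IsChainId w C (S.sort (· ≥ ·)) ∧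
      AllStrongDescents w C := by
  obtain ⟨C, hC, hs⟩ := exists_chain_of_steps (isExpansion_iff.2 (spread_letter w))
    (S.sort (· ≥ ·)) (Finset.sortedGT_sort S).isChain fun j hj =>
      mem_reducibles.1 (hS ((Finset.mem_sort _).1 hj))
  obtain ⟨u, hu⟩ : ∃ u, (w :: C).getLast? = some u := by
    rw [List.getLast?_cons]
    exact ⟨_, rfl⟩
  refine ⟨u, w :: C, ?_, ⟨hC.isChain, rfl, hu⟩, hC, _, hC, hs⟩
  rw [← decs_sort]
  exact hC.spread_getLast hu

theorem exists_spread_drop {w : PWord} {S : Finset ℕ} (hS : S ⊆ reducibles w) :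
    ∃ u, u ≤ w ∧ Spread (drop w S) u := by
  obtain ⟨u, -, hu, -⟩ := exists_chain_of_subset hS
  exact ⟨u, hu.le (spread_letter w) (drop_le w S), hu⟩

open Classical in
/-- The sets of reducible positions of `w` whose letters have to be lowered to obtain `u`. -/
noncomputable def dropSets (u w : PWord) : Finset (Finset ℕ) :=
  (reducibles w).powerset.filter fun S => Spread (drop w S) u

theorem mem_dropSets {u w : PWord} {S : Finset ℕ} :
    S ∈ dropSets u w ↔ S ⊆ reducibles w ∧ Spread (drop w S) u := by
  classical
  simp [dropSets]

theorem card_add_rank {u w : PWord} {S : Finset ℕ} (hS : S ∈ dropSets u w) :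
    S.card + rank u = rank w := by
  rw [mem_dropSets] at hS
  obtain ⟨M, hM⟩ := hS.2.rank_eq
  have hlt : ∀ i ∈ S, i < len w := fun i hi =>
    letter_pos_iff.1 (mem_reducibles.1 (hS.1 hi)).pos
  have : ∀ i, letter w i = drop w S i + if i ∈ S then 1 else 0 := by
    intro i
    unfold drop
    split_ifs with h
    · have := letter_pos_iff.2 (hlt i h)
      omega
    · rfl
  rw [hM (M + len w) (by omega), rank_eq_sum (v := w) (N := M + len w) (by omega),
    Finset.sum_congr rfl fun i _ => this i, Finset.sum_add_distrib, Finset.sum_ite_mem,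
    Finset.inter_eq_right.2 fun i hi => Finset.mem_range.2 (by have := hlt i hi; omega)]
  simp [add_comm]

/-- A chain is matched with the set of labels in its chain id; the id is this set sorted
decreasingly, and it determines the chain. -/
theorem strongCount_eq (u w : PWord) : strongCount u w = (dropSets u w).card := by
  rw [← Set.ncard_coe_finset]
  unfold strongCount
  have key : ∀ C, IsCritical u w C ∧ AllStrongDescents w C →
      ∃ S ∈ dropSets u w, IsChainId w C (S.sort (· ≥ ·)) := by
    rintro C ⟨⟨⟨h1, h2, h3⟩, -⟩, l, hl, hs⟩
    cases C with
    | nil => simp at h2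
    | cons v C =>
      simp only [List.head?_cons, Option.some.injEq] at h2
      subst h2
      obtain ⟨hc, hst⟩ := LabelsFrom.step_of_strong hl hs
      have hp := List.isChain_iff_pairwise.1 hc
      have hnd : l.Nodup := hp.imp fun h => ne_of_gt h
      have hsort : l.toFinset.sort (· ≥ ·) = l :=
        (List.toFinset_sort (· ≥ ·) hnd).2 (hp.imp fun h => le_of_lt h)
      refine ⟨l.toFinset, mem_dropSets.2 ⟨fun k hk => ?_, ?_⟩, by rwa [hsort]⟩
      · exact mem_reducibles.2 (hst k (List.mem_toFinset.1 hk))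
      · rw [← decs_sort, hsort]
        exact LabelsFrom.spread_getLast hl h3
  choose! F hF hF' using key
  refine Set.ncard_congr (fun C _ => F C) (fun C hC => hF C hC) (fun C C' hC hC' h => ?_)
    fun S hS => ?_
  · have h1 := hF' C hC
    have h2 := hF' C' hC'
    rw [h] at h1
    exact LabelsFrom.chain_unique h1 h2
  · obtain ⟨u', C, hu', hC, hid, hst⟩ := exists_chain_of_subset (mem_dropSets.1 hS).1
    obtain rfl := hu'.unique (mem_dropSets.1 hS).2
    have hC' : IsCritical u' w C ∧ AllStrongDescents w C :=
      ⟨isCritical_of_allStrongDescents hC hst, hst⟩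
    refine ⟨C, hC', ?_⟩
    rw [← Finset.sort_toFinset (F C) (· ≥ ·), ← Finset.sort_toFinset S (· ≥ ·)]
    exact congrArg _ (LabelsFrom.unique (hF' C hC') hid)

/-- All sets in `dropSets u w` have `ρ(u, w)` elements. The separate convention for `ρ(u, w) ≤ 1` is
no exception, because there is exactly one such set in that case. -/
theorem dTerm_eq_sum {u w : PWord} (h : u ≤ w) :
    dTerm u w = ∑ S ∈ dropSets u w, (-1 : ℤ) ^ S.card := by
  have hconst : ∀ S ∈ dropSets u w, (-1 : ℤ) ^ S.card = (-1) ^ (rank w - rank u) := by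
    intro S hS
    rw [← card_add_rank hS, Nat.add_sub_cancel]
  rw [Finset.sum_congr rfl hconst, Finset.sum_const, nsmul_eq_mul, ← strongCount_eq]
  unfold dTerm
  split_ifs with hr
  · rfl
  suffices H : strongCount u w = 1 by rw [H]; simp
  rw [strongCount_eq, Finset.card_eq_one]
  rcases h.eq_or_lt with rfl | hlt
  · refine ⟨∅, Finset.ext fun S => ?_⟩
    rw [Finset.mem_singleton]
    constructor
    · intro hS
      have := card_add_rank hS
      exact Finset.card_eq_zero.1 (by omega)
    · rintro rfl
      exact mem_dropSets.2 ⟨Finset.empty_subset _, by rw [drop_empty]; exact spread_letter u⟩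
  · have hr' := rank_strictMono hlt
    have hcov := covBy_of_rank h (by omega)
    obtain ⟨k, hk, hk'⟩ := (spread_letter w).exists_step hcov
    refine ⟨{k}, Finset.ext fun S => ?_⟩
    rw [Finset.mem_singleton]
    constructor
    · intro hS
      have := card_add_rank hS
      obtain ⟨j, rfl⟩ := Finset.card_eq_one.1 (show S.card = 1 by omega)
      rw [mem_dropSets, Finset.singleton_subset_iff, mem_reducibles, drop_singleton] at hS
      rw [Step.unique (spread_letter w) hk hS.1 hk' hS.2]
    · rintro rfl
      rw [mem_dropSets, Finset.singleton_subset_iff, mem_reducibles, drop_singleton]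
      exact ⟨hk, hk'⟩

-- After exchanging the sums, each `S` produces exactly one word below `w`, and that word is counted
-- when it lies above `y`.
open Classical in
theorem sum_dTerm (y w : PWord) :
    ∑ u ∈ Finset.Icc y w, dTerm u w =
      ∑ S ∈ (reducibles w).powerset.filter fun S => ∃ a, Fits y (drop w S) a,
        (-1 : ℤ) ^ S.card := by
  rw [Finset.sum_congr rfl fun u hu => dTerm_eq_sum (Finset.mem_Icc.1 hu).2]
  simp only [dropSets, Finset.sum_filter]
  rw [Finset.sum_comm]
  refine Finset.sum_congr rfl fun S hS => ?_
  obtain ⟨v, hvw, hv⟩ := exists_spread_drop (Finset.mem_powerset.1 hS)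
  have : ∀ u, Spread (drop w S) u ↔ u = v :=
    fun u => ⟨fun h => h.unique hv, fun h => h ▸ hv⟩
  simp only [this, Finset.sum_ite_eq', Finset.mem_Icc, hvw, and_true, hv.le_iff]

/-! ### Signed counts of sets of positions -/

open Classical in
/-- The sum of `(-1)^|S|` over the subsets `S` of `R` with the property `P`. -/
noncomputable def signedCount (R : Finset ℕ) (P : Finset ℕ → Prop) : ℤ :=
  ∑ S ∈ R.powerset.filter P, (-1) ^ S.card

theorem signedCount_congr {R : Finset ℕ} {P Q : Finset ℕ → Prop} (h : ∀ S ⊆ R, P S ↔ Q S) :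
    signedCount R P = signedCount R Q := by
  classical
  unfold signedCount
  congr 1
  exact Finset.filter_congr fun S hS => h S (Finset.mem_powerset.1 hS)

theorem signedCount_of_forall_not {R : Finset ℕ} {P : Finset ℕ → Prop} (h : ∀ S ⊆ R, ¬ P S) :
    signedCount R P = 0 := by
  classical
  unfold signedCount
  rw [Finset.filter_eq_empty_iff.2 fun S hS => h S (Finset.mem_powerset.1 hS), Finset.sum_empty]

theorem signedCount_or (R : Finset ℕ) (P Q : Finset ℕ → Prop) :
    signedCount R (fun S => P S ∨ Q S) =
      signedCount R P + signedCount R Q - signedCount R fun S => P S ∧ Q S := by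
  classical
  unfold signedCount
  simp only [Finset.sum_filter]
  rw [← Finset.sum_add_distrib, ← Finset.sum_sub_distrib]
  refine Finset.sum_congr rfl fun S _ => ?_
  by_cases h1 : P S <;> by_cases h2 : Q S <;> simp [h1, h2]

/-- The sets `S` and `insert k S` have opposite signs and cancel when both satisfy `P`. What remains
are the sets for which adding `k` destroys `P`. -/
theorem signedCount_toggle {R : Finset ℕ} {P : Finset ℕ → Prop} {k : ℕ} (hk : k ∈ R)
    (h : ∀ S ⊆ R, k ∉ S → P (insert k S) → P S) :
    signedCount R P = signedCount R fun S => k ∉ S ∧ P S ∧ ¬ P (insert k S) := by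
  classical
  unfold signedCount
  simp only [Finset.sum_filter]
  have hR : R = insert k (R.erase k) := (Finset.insert_erase hk).symm
  rw [hR, Finset.sum_powerset_insert (Finset.notMem_erase _ _),
    Finset.sum_powerset_insert (Finset.notMem_erase _ _), ← Finset.sum_add_distrib,
    ← Finset.sum_add_distrib]
  refine Finset.sum_congr rfl fun S hS => ?_
  rw [Finset.mem_powerset] at hS
  have hkS : k ∉ S := fun h => Finset.notMem_erase k R (hS h)
  have := h S (hS.trans (Finset.erase_subset _ _)) hkS
  by_cases h1 : P S <;> by_cases h2 : P (insert k S) <;>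
    simp [h1, h2, hkS, pow_succ]
  exact h1 (this h2)

theorem signedCount_eq_zero {R : Finset ℕ} {P : Finset ℕ → Prop} {k : ℕ} (hk : k ∈ R)
    (h : ∀ S ⊆ R, k ∉ S → (P (insert k S) ↔ P S)) : signedCount R P = 0 := by
  rw [signedCount_toggle hk fun S h1 h2 => (h S h1 h2).1]
  exact signedCount_of_forall_not fun S hS h' => h'.2.2 ((h S hS h'.1).2 h'.2.1)

theorem drop_insert_le (w : PWord) (S : Finset ℕ) (k j : ℕ) :
    drop w (insert k S) j ≤ drop w S j := by
  unfold drop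
  by_cases h : j ∈ S
  · simp [h]
  · simp only [h, if_false, Nat.sub_zero]
    exact Nat.sub_le _ _

theorem Fits.of_insert {y w : PWord} {S : Finset ℕ} {a k : ℕ} (h : Fits y (drop w (insert k S)) a) :
    Fits y (drop w S) a := h.mono (drop_insert_le w S k)

theorem drop_insert {w : PWord} {S : Finset ℕ} {k : ℕ} (hk : k ∉ S) :
    drop w (insert k S) = dec (drop w S) k := by
  funext j
  by_cases h : j = k
  · subst h
    simp [drop, dec_self, hk]
  · rw [dec_of_ne _ h]
    simp [drop, h]

theorem drop_of_notMem {w : PWord} {S : Finset ℕ} {k : ℕ} (hk : k ∉ S) : drop w S k = letter w k := by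
  simp [drop, hk]

theorem Fits.insert {y w : PWord} {S : Finset ℕ} {a k : ℕ} (h : Fits y (drop w S) a) (hk : k ∉ S)
    (hlt : ∀ j < len y, a + j = k → letter y j < letter w k) :
    Fits y (drop w (insert k S)) a := by
  rw [drop_insert hk]
  exact h.dec fun j hj e => by rw [drop_of_notMem hk]; exact hlt j hj e

/-! ### Signed counts of the sets that preserve an occurrence of a word -/

theorem flat_of_le {y w : PWord} (h : y ≤ w) (hw : Flat w) : Flat y := by
  obtain ⟨a, ha⟩ := le_iff_fits.1 h
  refine flat_iff.2 fun i => ?_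
  by_cases hi : i < len y
  · exact (ha i hi).trans (flat_iff.1 hw _)
  · rw [letter_eq_zero (not_lt.1 hi)]
    omega

theorem zero_mem_reducibles {w : PWord} (h : 0 < len w) : 0 ∈ reducibles w := by
  rw [mem_reducibles]
  have := letter_pos_iff.2 h
  by_cases h1 : 1 < letter w 0
  · exact .inl h1
  · exact .inr (.inl ⟨by omega, by simp⟩)

theorem last_mem_reducibles {w : PWord} (h : ¬ Flat w) : len w - 1 ∈ reducibles w := by
  rw [mem_reducibles]
  have h0 : 0 < len w := by
    by_contra hc
    exact h (flat_iff.2 fun i => by rw [letter_eq_zero (by omega)]; omega)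
  have := letter_pos_iff.2 (show len w - 1 < len w by omega)
  by_cases h1 : 1 < letter w (len w - 1)
  · exact .inl h1
  · exact .inr (.inr ⟨h, by omega, fun j hj => letter_eq_zero (by omega)⟩)

theorem len_pos_of_not_flat {y : PWord} (h : ¬ Flat y) : 0 < len y := by
  by_contra hc
  exact h (flat_iff.2 fun i => by rw [letter_eq_zero (by omega)]; omega)

/-- If `w` is flat, its only reducible letter is the first: a shorter `y` always fits at position
`1`, a longer one never fits. If `w` is not flat, a letter greater than `1` still dominates a `1`
after being lowered, so it can be toggled. -/
theorem signedCount_fits_flat {y w : PWord} (hy : Flat y) (hne : y ≠ w) :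
    signedCount (reducibles w) (fun S => ∃ a, Fits y (drop w S) a) = 0 := by
  by_cases hw : Flat w
  · have hw' := flat_iff.1 hw
    have hy' := flat_iff.1 hy
    have hlen : len y ≠ len w := by
      intro hlen
      refine hne (ext_letter fun i => ?_)
      have h1 := hw' i
      have h2 := hy' i
      by_cases hi : i < len y
      · have := letter_pos_iff.2 hi
        have := letter_pos_iff.2 (hlen ▸ hi)
        omega
      · rw [letter_eq_zero (not_lt.1 hi), letter_eq_zero (by omega)]
    rcases lt_or_gt_of_ne hlen with hlt | hgt
    · have hfit : ∀ S ⊆ reducibles w, Fits y (drop w S) 1 := by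
        intro S hS j hj
        have h1 : 1 + j ∉ S := by
          intro h
          rcases mem_reducibles.1 (hS h) with h | h | h
          · have := hw' (1 + j)
            omega
          · have := h.2 0 (by omega)
            have := letter_pos_iff.2 (show 0 < len w by omega)
            omega
          · exact h.1 hw
        rw [drop_of_notMem h1]
        have := letter_pos_iff.2 (show 1 + j < len w by omega)
        have := hy' j
        omega
      have h0 := zero_mem_reducibles (w := w) (by omega)
      exact signedCount_eq_zero h0 fun S hS _ =>
        ⟨fun _ => ⟨1, hfit S hS⟩, fun _ => ⟨1, hfit _ (Finset.insert_subset h0 hS)⟩⟩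
    · refine signedCount_of_forall_not fun S _ ⟨a, ha⟩ => ?_
      have := (ha.mono (drop_le w S)).add_le_len (by omega)
      omega
  · obtain ⟨k, hk⟩ : ∃ k, 1 < letter w k := by
      by_contra hc
      push Not at hc
      exact hw (flat_iff.2 hc)
    refine signedCount_eq_zero (mem_reducibles.2 (.inl hk)) fun S _ hkS =>
      ⟨fun ⟨a, ha⟩ => ⟨a, ha.of_insert⟩, fun ⟨a, ha⟩ => ⟨a, ha.insert hkS fun j _ _ => ?_⟩⟩
    exact (flat_iff.1 hy j).trans_lt hk

/-- The first position of a letter greater than `1` of `w` that exceeds the letter of `y`. -/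
noncomputable def excessIndex (y w : PWord) : ℕ :=
  sInf {k | 1 < letter w k ∧ letter y k < letter w k}

/-- Otherwise `y` would dominate every letter greater than `1` of `w`. Starting from `y(b) > 1`, the
occurrence at `a` gives `w(a + b) > 1`, hence `y(a + b) > 1`, and so on along `b, a + b, 2a + b, …`,
past the end of `y`. -/
theorem exists_excess {y w : PWord} {a : ℕ} (hy : ¬ Flat y) (ha : 0 < a)
    (h : Fits y (letter w) a) : ∃ k, (1 < letter w k ∧ letter y k < letter w k) := by
  by_contra hc
  push Not at hc
  obtain ⟨b, hb⟩ : ∃ b, 1 < letter y b := by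
    by_contra hc
    push Not at hc
    exact hy (flat_iff.2 hc)
  have : ∀ n, 1 < letter y (n * a + b) := by
    intro n
    induction n with
    | zero => simpa using hb
    | succ n ih =>
      have h1 := h (n * a + b) (letter_pos_iff.1 (by omega))
      have h2 := hc (a + (n * a + b)) (by omega)
      rw [show (n + 1) * a + b = a + (n * a + b) by ring]
      omega
  have h1 := letter_pos_iff.1 ((Nat.zero_lt_one.trans (this (len y))))
  have := Nat.le_mul_of_pos_right (len y) ha
  omega

/-- `y` is a prefix of `w` with `S` lowered and occurs elsewhere in it, but no longer does so when
the excess index is added to `S`. -/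
def IsTight (y w : PWord) (S : Finset ℕ) : Prop :=
  excessIndex y w ∉ S ∧ Fits y (drop w S) 0 ∧ (∃ a > 0, Fits y (drop w S) a) ∧
    ¬ ∃ a > 0, Fits y (drop w (insert (excessIndex y w) S)) a

/-- Some reducible letter of `w` exceeds the letter of `y` at its place: a letter where they differ
if the lengths agree, the last letter of `w` if `y` is shorter. Toggling it does not affect an
occurrence at the beginning. -/
theorem signedCount_fits_prefix {y w : PWord} (hy : ¬ Flat y) (hne : y ≠ w) :
    signedCount (reducibles w) (fun S => Fits y (drop w S) 0) = 0 := by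
  by_cases h0 : Fits y (letter w) 0
  · obtain ⟨k, hk, hlt⟩ : ∃ k ∈ reducibles w, letter y k < letter w k := by
      have hle : y ≤ w := le_iff_fits.2 ⟨0, h0⟩
      have hl := hle.len_le
      by_cases hlen : len y = len w
      · by_contra hc
        push Not at hc
        refine hne (ext_letter fun i => ?_)
        by_cases hi : i < len y
        · have h1 := h0 i hi
          rw [zero_add] at h1
          by_contra hne'
          have := letter_pos_iff.2 hi
          have := hc i (mem_reducibles.2 (.inl (by omega)))
          omega
        · rw [letter_eq_zero (not_lt.1 hi), letter_eq_zero (by omega)]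
      · have := letter_pos_iff.2 (show len w - 1 < len w by omega)
        exact ⟨len w - 1, last_mem_reducibles fun h => hy (flat_of_le hle h),
          by rw [letter_eq_zero (v := y) (by omega)]; exact this⟩
    refine signedCount_eq_zero hk fun S _ hkS => ⟨Fits.of_insert, fun h => h.insert hkS ?_⟩
    rintro j _ e
    obtain rfl : j = k := by omega
    exact hlt
  · exact signedCount_of_forall_not fun S _ h => h0 (h.mono (drop_le w S))

/-- The count for occurrences at the beginning vanishes, and so does the one for later occurrences,
since these ignore position `0`. Only the intersection survives, with a minus sign. Lowering the
excess index keeps the occurrence at the beginning, so toggling it leaves the sets for which all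
later occurrences are lost. -/
theorem signedCount_fits_not_flat {y w : PWord} (hy : ¬ Flat y) (hne : y ≠ w) :
    signedCount (reducibles w) (fun S => ∃ a, Fits y (drop w S) a) =
      - signedCount (reducibles w) (IsTight y w) := by
  have h1 : ∀ S ⊆ reducibles w, (∃ a, Fits y (drop w S) a) ↔
      (Fits y (drop w S) 0 ∨ ∃ a > 0, Fits y (drop w S) a) := by
    intro S _
    constructor
    · rintro ⟨a, ha⟩
      rcases Nat.eq_zero_or_pos a with rfl | h
      · exact .inl ha
      · exact .inr ⟨a, h, ha⟩
    · rintro (h | ⟨a, -, h⟩)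
      · exact ⟨0, h⟩
      · exact ⟨a, h⟩
  have h2 : signedCount (reducibles w) (fun S => ∃ a > 0, Fits y (drop w S) a) = 0 := by
    by_cases hw : 0 < len w
    · refine signedCount_eq_zero (zero_mem_reducibles hw) fun S _ h0 =>
        ⟨fun ⟨a, h, ha⟩ => ⟨a, h, ha.of_insert⟩, fun ⟨a, h, ha⟩ => ⟨a, h, ha.insert h0 ?_⟩⟩
      intro j _ e
      omega
    · refine signedCount_of_forall_not fun S _ ⟨a, _, ha⟩ => ?_
      have hl := len_pos_of_not_flat hy
      have := (ha.mono (drop_le w S)).add_le_len hl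
      omega
  rw [signedCount_congr h1, signedCount_or, signedCount_fits_prefix hy hne, h2, zero_add, zero_sub,
    neg_inj]
  by_cases hex : ∃ k, (1 < letter w k ∧ letter y k < letter w k)
  · have hk : 1 < letter w (excessIndex y w) ∧
        letter y (excessIndex y w) < letter w (excessIndex y w) := Nat.sInf_mem hex
    rw [signedCount_toggle (mem_reducibles.2 (.inl hk.1)) fun S _ _ h =>
      ⟨h.1.of_insert, h.2.imp fun a ha => ⟨ha.1, ha.2.of_insert⟩⟩]
    refine signedCount_congr fun S _ => ?_
    unfold IsTight
    have : excessIndex y w ∉ S → Fits y (drop w S) 0 →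
        Fits y (drop w (insert (excessIndex y w) S)) 0 := by
      intro hkS h
      refine h.insert hkS fun j _ e => ?_
      rw [zero_add] at e
      rw [e]
      exact hk.2
    exact ⟨fun ⟨h1, ⟨h2, h3⟩, h4⟩ => ⟨h1, h2, h3, fun h => h4 ⟨this h1 h2, h⟩⟩,
      fun ⟨h1, h2, h3, h4⟩ => ⟨h1, ⟨h2, h3⟩, fun h => h4 h.2⟩⟩
  · have hno : ∀ S, ¬ ∃ a > 0, Fits y (drop w S) a := fun S ⟨a, h, ha⟩ =>
      hex (exists_excess hy h (ha.mono (drop_le w S)))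
    rw [signedCount_of_forall_not fun S _ h => hno S h.2,
      signedCount_of_forall_not fun S _ h => hno S h.2.2.1]

/-! ### Outer factors -/

theorem isPrefix_iff {u w : PWord} : IsPrefix u w ↔ len u ≤ len w ∧ Fits u (letter w) 0 := by
  simp [IsPrefix, Fits]

theorem isSuffix_iff {u w : PWord} :
    IsSuffix u w ↔ len u ≤ len w ∧ Fits u (letter w) (len w - len u) := Iff.rfl

theorem isOuter_iff {p w : PWord} : IsOuter p w ↔
    len p < len w ∧ Fits p (letter w) 0 ∧ Fits p (letter w) (len w - len p) := by
  unfold IsOuter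
  rw [isPrefix_iff, isSuffix_iff]
  constructor
  · rintro ⟨h1, h2, h3⟩
    exact ⟨h1, h2.2, h3.2⟩
  · rintro ⟨h1, h2, h3⟩
    exact ⟨h1, ⟨h1.le, h2⟩, h1.le, h3⟩

/-- A maximal outer factor does not occur in the interior of the word. -/
theorem IsMaximalOuter.not_fits {p v : PWord} {b : ℕ} (h : IsMaximalOuter p v) (hb : 0 < b)
    (hb' : b + len p < len v) : ¬ Fits p (letter v) b := by
  intro hf
  obtain ⟨q, hq⟩ := exists_letter_eq (f := fun k => min (letter v k) (letter v (b + k)))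
    (n := len v - b) fun k => by
      simp only [lt_min_iff, letter_pos_iff]
      omega
  have hlen : len q = len v - b := len_eq_iff.2 fun k => by
    rw [hq]
    simp only [lt_min_iff, letter_pos_iff]
    omega
  have h0 := (isOuter_iff.1 h.1).2.1
  refine h.2 q (isOuter_iff.2 ⟨by omega, fun j _ => ?_, fun j _ => ?_⟩) (by omega)
    (le_iff_fits.2 ⟨0, fun j hj => ?_⟩)
  · rw [hq, zero_add]
    exact min_le_left _ _
  · rw [hq, hlen, show len v - (len v - b) = b by omega]
    exact min_le_right _ _
  · rw [hq, zero_add]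
    refine le_min ?_ (hf j hj)
    have := h0 j hj
    rwa [zero_add] at this

theorem Fits.withOnes {y : PWord} {f : ℕ → ℕ} {a i : ℕ} (h : Fits y f a)
    (h1 : ∀ j, len y ≤ j → j < len y + i → 0 < f (a + j)) : Fits (withOnes y i) f a := by
  intro j hj
  rw [len_withOnes] at hj
  rw [letter_withOnes]
  split_ifs with h2
  · exact h j h2
  · exact h1 j (by omega) hj

theorem Fits.of_withOnes {y : PWord} {f : ℕ → ℕ} {a i : ℕ} (h : Fits (PWord.withOnes y i) f a) :
    Fits y f a := by
  intro j hj
  have := h j (by rw [len_withOnes]; omega)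
  rwa [letter_withOnes, if_pos hj] at this

theorem letter_le_letter_withOnes (y : PWord) (i k : ℕ) :
    letter y k ≤ letter (withOnes y i) k := by
  rw [letter_withOnes]
  split_ifs with h1
  · exact le_rfl
  · rw [letter_eq_zero (not_lt.1 h1)]
    omega
  · rw [letter_eq_zero (not_lt.1 h1)]

theorem withOnes_add (y : PWord) (i m : ℕ) : withOnes (withOnes y i) m = withOnes y (i + m) := by
  simp [withOnes, ← List.replicate_append_replicate, List.append_assoc]

theorem withOnes_injective (m : ℕ) : Function.Injective fun y => withOnes y m := by
  intro x y h
  exact PWord.ext (List.append_cancel_right (PWord.ext_iff.1 h))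

theorem flat_withOnes {y : PWord} {i : ℕ} : Flat (withOnes y i) ↔ Flat y := by
  simp only [Flat, withOnes, List.mem_append, List.mem_replicate]
  constructor
  · exact fun h a ha => h a (.inl ha)
  · rintro h a (ha | ha)
    · exact h a ha
    · exact ha.2

/-- Of two such words the shorter is a prefix of the longer, against its maximality. -/
theorem IsMaximalOuter.withOnes_unique {y v : PWord} {i i' : ℕ}
    (h : IsMaximalOuter (withOnes y i) v) (h' : IsMaximalOuter (withOnes y i') v) : i = i' := by
  wlog hlt : i < i' generalizing i i'
  · by_contra hne
    exact hne (this h' h (by omega)).symm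
  refine absurd (le_iff_fits.2 ⟨0, Fits.withOnes (fun j hj => ?_) fun j h1 h2 => ?_⟩)
    (h.2 _ h'.1 (by rw [len_withOnes, len_withOnes]; omega))
  · rw [zero_add]
    exact letter_le_letter_withOnes y i' j
  · exact letter_pos_iff.2 (by rw [len_withOnes]; omega)

theorem Reducible.of_one_lt {v : PWord} {k : ℕ} (h : 1 < letter v k) : Reducible v k :=
  ⟨letter_pos_iff.1 (by omega), .inl h⟩

theorem excessIndex_mem {y v : PWord} {a : ℕ} (hy : ¬ Flat y) (ha : 0 < a)
    (h : Fits y (letter v) a) : 1 < letter v (excessIndex y v) ∧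
      letter y (excessIndex y v) < letter v (excessIndex y v) :=
  Nat.sInf_mem (exists_excess hy ha h)

theorem excessIndex_le {y v : PWord} {k : ℕ} (h : 1 < letter v k) (h' : letter y k < letter v k) :
    excessIndex y v ≤ k := Nat.sInf_le ⟨h, h'⟩

/-- The principal index of a nonflat outer factor points to a letter greater than `1`, and it does
not change when ones at the end of the factor are removed. -/
theorem principalIndex_withOnes {y v : PWord} {i : ℕ} (hy : ¬ Flat y)
    (h : IsOuter (withOnes y i) v) : principalIndex (withOnes y i) v = excessIndex y v := by
  rw [isOuter_iff] at h
  obtain ⟨hlen, -, hs⟩ := h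
  have hmem := excessIndex_mem hy (Nat.sub_pos_of_lt hlen) hs.of_withOnes
  have hlt : letter (withOnes y i) (excessIndex y v) < letter v (excessIndex y v) := by
    rw [letter_withOnes]
    split_ifs <;> omega
  have hin : excessIndex y v ∈
      {k | letter (withOnes y i) k < letter v k ∧ Reducible v k} := ⟨hlt, .of_one_lt hmem.1⟩
  have hle : principalIndex (withOnes y i) v ≤ excessIndex y v := Nat.sInf_le hin
  refine le_antisymm hle ?_
  have hp : principalIndex (withOnes y i) v ∈
      {k | letter (withOnes y i) k < letter v k ∧ Reducible v k} := Nat.sInf_mem ⟨_, hin⟩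
  set k := principalIndex (withOnes y i) v with hk
  obtain ⟨h1, h2, h3⟩ := hp
  have hyk := letter_le_letter_withOnes y i k
  by_cases hv : 1 < letter v k
  · exact excessIndex_le hv (by omega)
  -- A `1` of `v` can exceed `p` only beyond the end of `p`; being reducible, it is then the last
  -- letter of `v`, so the excess index does not come after it.
  · have h4 : len (withOnes y i) ≤ k := by
      by_contra hc
      have := letter_pos_iff.2 (not_le.1 hc)
      omega
    have hl := len_pos_of_not_flat hy
    rw [len_withOnes] at h4
    have := letter_pos_iff.1 (show 0 < letter v (excessIndex y v) by omega)
    omega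

theorem excessIndex_congr {y v w : PWord} {a : ℕ} (hy : ¬ Flat y) (ha : 0 < a)
    (h : Fits y (letter v) a) (hvw : ∀ k ≤ excessIndex y v, letter v k = letter w k) :
    excessIndex y w = excessIndex y v := by
  have hmem := excessIndex_mem hy ha h
  have hin : 1 < letter w (excessIndex y v) ∧
      letter y (excessIndex y v) < letter w (excessIndex y v) := by
    rwa [← hvw _ le_rfl]
  have hle := excessIndex_le hin.1 hin.2
  refine le_antisymm hle ?_
  have hin' : 1 < letter w (excessIndex y w) ∧
      letter y (excessIndex y w) < letter w (excessIndex y w) :=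
    Nat.sInf_mem (s := {k | 1 < letter w k ∧ letter y k < letter w k}) ⟨_, hin⟩
  rw [← hvw _ hle] at hin'
  exact excessIndex_le hin'.1 hin'.2

/-- Reducing a letter greater than `1` happens in place. This case suffices, since principal indices
point to such letters. -/
theorem getD_reduceList (l : List ℕ+) (i : ℕ) (h : 1 < (l.map PNat.val).getD i 0) (k : ℕ) :
    ((reduceList l i).map PNat.val).getD k 0 = dec (fun k => (l.map PNat.val).getD k 0) i k := by
  induction l generalizing i k with
  | nil => simp at h
  | cons a l ih =>
    cases i with
    | zero =>
      have ha : 1 < (a : ℕ) := by simpa using h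
      have ha' : (1 : ℕ+) < a := ha
      rw [reduceList, if_neg ha'.ne']
      cases k with
      | zero =>
        rw [dec_self]
        simp [PNat.sub_coe, ha']
      | succ k =>
        rw [dec_of_ne _ (by omega)]
        simp
    | succ i =>
      rw [reduceList]
      cases k with
      | zero =>
        rw [dec_of_ne _ (by omega)]
        simp
      | succ k =>
        have := ih i (by simpa using h) k
        rw [List.map_cons, List.getD_cons_succ, this]
        by_cases e : k = i
        · subst e
          rw [dec_self, dec_self]
          simp
        · rw [dec_of_ne _ e, dec_of_ne _ (by omega)]
          simp

theorem letter_reduce {v : PWord} {i : ℕ} (h : 1 < letter v i) :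
    letter (reduce v i) = dec (letter v) i := funext (getD_reduceList v.letters i h)

theorem len_reduce {v : PWord} {i : ℕ} (h : 1 < letter v i) : len (reduce v i) = len v :=
  len_eq_iff.2 fun k => by rw [letter_reduce h, dec_pos_iff_of_one_lt h, letter_pos_iff]

/-! ### Bases -/

/-- The positions at which the base `v` is smaller than `w`. -/
def dropped (v w : PWord) : Finset ℕ :=
  (Finset.range (len w)).filter fun j => letter v j + 1 = letter w j

theorem mem_dropped {v w : PWord} {j : ℕ} : j ∈ dropped v w ↔ letter v j + 1 = letter w j := by
  simp only [dropped, Finset.mem_filter, Finset.mem_range, and_iff_right_iff_imp]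
  exact fun h => letter_pos_iff.1 (by omega)

theorem card_dropped (v w : PWord) : (dropped v w).card = degree v w := rfl

theorem IsBase.letter_eq {v w : PWord} (h : IsBase v w) : letter v = drop w (dropped v w) := by
  funext j
  unfold drop
  simp only [mem_dropped]
  by_cases hj : j < len w
  · rcases h.2 j hj with e | e
    · rw [if_neg (by omega), e, Nat.sub_zero]
    · rw [if_pos e]
      omega
  · have := h.1
    rw [letter_eq_zero (v := v) (by omega), letter_eq_zero (v := w) (by omega)]
    simp

/-- The bound on `k` matters when nothing is dropped: `firstDrop` is then `len w` and the right side
is vacuous. -/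
theorem lt_firstDrop_iff {v w : PWord} {k : ℕ} (hk : k < len w) :
    k < firstDrop v w ↔ ∀ j ∈ dropped v w, k < j := by
  unfold firstDrop
  rw [← card_dropped]
  split_ifs with h
  · rw [Finset.card_eq_zero] at h
    simp [h, hk]
  · rw [← ne_eq, Finset.card_ne_zero] at h
    obtain ⟨j, hj⟩ := h
    have hmem : letter v _ + 1 = letter w _ :=
      Nat.sInf_mem (s := {j | letter v j + 1 = letter w j}) ⟨j, mem_dropped.1 hj⟩
    constructor
    · intro h j hj
      exact h.trans_le (Nat.sInf_le (mem_dropped.1 hj))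
    · intro h
      exact h _ (mem_dropped.2 hmem)

/-! ### Tight sets and principal factors -/

/-- `y` arises from the principal factor `p` of `v` by removing fewer ones than are removed for the
primary prefix. -/
def IsCounted (y v p : PWord) : Prop :=
  ∃ i, p = withOnes y i ∧ ∀ r < i, ¬ IsOuter (withOnes y r) (reduce v (principalIndex p v))

/-- The principal index of `p` in `v` is the excess index of `y`, and it is the same in `w` because
it precedes all drops. Suppose that a later occurrence of `y` survived its reduction, with `r`
letters after it. Extend it by ones: for `r < i` this gives the outer factor `y1^r` of the reduced
word, for `r = i` it makes `p` a suffix of that word, and for `r > i` it puts `p` into the interior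
of `v`. All three are excluded. -/
theorem isTight_dropped {y v p w : PWord} (hy : ¬ Flat y) (hq : (v, p) ∈ principalPairs w)
    (hc : IsCounted y v p) : dropped v w ⊆ reducibles w ∧ IsTight y w (dropped v w) := by
  obtain ⟨hbase, ⟨hmax, -, hsuf⟩, hlt⟩ := hq
  dsimp only at hbase hmax hsuf hlt
  obtain ⟨i, rfl, hr⟩ := hc
  have hlet := hbase.letter_eq
  obtain ⟨hlen, hp, hs⟩ := isOuter_iff.1 hmax.1
  rw [principalIndex_withOnes hy hmax.1] at hsuf hlt hr
  have hmem := excessIndex_mem hy (Nat.sub_pos_of_lt hlen) hs.of_withOnes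
  set k := excessIndex y v with hk
  have hkw : k < len w := letter_pos_iff.1 (by
    have := drop_le w (dropped v w) k
    rw [← hlet] at this
    omega)
  have hdrop := (lt_firstDrop_iff hkw).1 hlt
  have hexc : excessIndex y w = k :=
    excessIndex_congr hy (Nat.sub_pos_of_lt hlen) hs.of_withOnes fun k' hk' => by
      rw [hlet, drop_of_notMem fun h => absurd (hdrop k' h) (by omega)]
  have hwf : ¬ Flat w := fun h => hy (flat_withOnes.1
    (flat_of_le hmax.1.2.1.le (flat_of_le hbase.le h)))
  refine ⟨fun j hj => ?_, ?_⟩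
  · rw [mem_reducibles]
    have h1 := mem_dropped.1 hj
    by_cases h2 : 1 < letter w j
    · exact .inl h2
    -- A `1` lowered to `0` makes the base shorter by one, so it is the last letter of `w`.
    · have h3 := letter_pos_iff.1 (show 0 < letter w j by omega)
      have h4 := letter_pos_iff.not.1 (show ¬ 0 < letter v j by omega)
      have h5 := hbase.1
      exact .inr (.inr ⟨hwf, by omega, fun j' hj' => letter_eq_zero (by omega)⟩)
  · unfold IsTight
    have hknot : k ∉ dropped v w := fun h => lt_irrefl _ (hdrop k h)
    rw [hexc, drop_insert hknot, ← hlet]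
    refine ⟨hknot, hp.of_withOnes, ⟨_, Nat.sub_pos_of_lt hlen, hs.of_withOnes⟩, ?_⟩
    rintro ⟨b, hb, hf⟩
    have hyl := len_pos_of_not_flat hy
    have hbl := (hf.mono (dec_le _ k)).add_le_len hyl
    have hpos : ∀ j, 0 < dec (letter v) k j ↔ j < len v := fun j => by
      rw [dec_pos_iff_of_one_lt hmem.1, letter_pos_iff]
    rw [len_withOnes] at hlen
    have hred := letter_reduce hmem.1
    have hlred := len_reduce hmem.1
    by_cases hri : len v - b - len y < i
    · refine hr _ hri (isOuter_iff.2 ?_)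
      rw [hred, hlred, len_withOnes]
      refine ⟨by omega, Fits.dec (hp.of_withOnes.withOnes fun j h1 h2 => ?_) fun j h1 h2 => ?_, ?_⟩
      · exact letter_pos_iff.2 (by omega)
      · obtain rfl : j = k := by omega
        rw [letter_withOnes]
        split_ifs <;> omega
      · rw [show len v - (len y + (len v - b - len y)) = b by omega]
        exact hf.withOnes fun j h1 h2 => (hpos _).2 (by omega)
    · have hfi : Fits (withOnes y i) (dec (letter v) k) b :=
        hf.withOnes fun j h1 h2 => (hpos _).2 (by omega)
      by_cases hri' : len v - b - len y = i
      · refine hsuf (isSuffix_iff.2 ?_)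
        rw [hred, hlred, len_withOnes, show len v - (len y + i) = b by omega]
        exact ⟨by omega, hfi⟩
      · exact hmax.not_fits hb (by rw [len_withOnes]; omega) (hfi.mono (dec_le _ k))

theorem eq_of_dropped_eq {y v p v' p' w : PWord} (hq : (v, p) ∈ principalPairs w)
    (hc : IsCounted y v p) (hq' : (v', p') ∈ principalPairs w) (hc' : IsCounted y v' p')
    (h : dropped v w = dropped v' w) : v = v' ∧ p = p' := by
  obtain rfl : v = v' := ext_letter fun j => by
    rw [hq.1.letter_eq, hq'.1.letter_eq]
    exact congrArg (fun S => drop w S j) h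
  obtain ⟨i, rfl, -⟩ := hc
  obtain ⟨i', rfl, -⟩ := hc'
  rw [hq.2.1.1.withOnes_unique hq'.2.1.1]
  exact ⟨rfl, rfl⟩

/-- The occurrence at the beginning gives `y(j) < w(j)` for `j ∈ S`, so minimality of the excess
index settles letters greater than `1`. A first `1` in `S` would destroy that occurrence, and a last
`1` has no letter after it. -/
theorem excessIndex_lt_of_isTight {y w : PWord} {S : Finset ℕ} (hy : ¬ Flat y)
    (hS : S ⊆ reducibles w) (h : IsTight y w S) : ∀ j ∈ S, excessIndex y w < j := by
  obtain ⟨hk, h0, ⟨a, ha, hfa⟩, -⟩ := h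
  intro j hj
  have hmem := excessIndex_mem hy ha (hfa.mono (drop_le w S))
  have hne : excessIndex y w ≠ j := fun e => hk (e ▸ hj)
  by_contra hlt
  have hyj : letter y j ≤ letter w j - 1 := by
    by_cases hjy : j < len y
    · have := h0 j hjy
      rw [zero_add] at this
      simpa [drop, hj] using this
    · rw [letter_eq_zero (not_lt.1 hjy)]
      omega
  rcases mem_reducibles.1 (hS hj) with h | h | h
  · exact hlt (lt_of_le_of_ne (excessIndex_le h (by omega)) hne)
  · have hjz : j = 0 := by
      by_contra hj0
      have h1 := h.2 0 (by omega)
      have h2 := letter_pos_iff.1 (show 0 < letter w j by omega)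
      have := letter_pos_iff.2 (show 0 < len w by omega)
      omega
    subst hjz
    have := letter_pos_iff.2 (len_pos_of_not_flat hy)
    omega
  · have := h.2.2 _ (show excessIndex y w > j by
      rcases lt_or_gt_of_ne hne with h' | h'
      · exact absurd h' hlt
      · exact h')
    omega

theorem exists_letter_eq_drop {y w : PWord} {S : Finset ℕ} (hS : S ⊆ reducibles w)
    (hy : 0 < len y) (h0 : Fits y (drop w S) 0) :
    ∃ v, letter v = drop w S ∧ IsBase v w ∧ dropped v w = S := by
  have hz : 0 < drop w S 0 := (letter_pos_iff.2 hy).trans_le (h0 0 hy)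
  obtain ⟨v, hvw, A, hA⟩ := exists_spread_drop hS
  have hA0 : A = 0 := by
    have := (hA.pos_iff 0).1 hz
    omega
  subst hA0
  have hlet : letter v = drop w S := funext fun j => by rw [← hA.1, zero_add]
  have hpos : ∀ j ∈ S, 0 < letter w j := fun j hj => (mem_reducibles.1 (hS hj)).pos
  refine ⟨v, hlet, ⟨?_, fun j hj => ?_⟩, ?_⟩
  -- If two or more letters were lost, the first lost one would be a reducible `1` at neither end of
  -- `w`; position `0` is not lost, by `hz`.
  · have h1 := hvw.len_le
    by_contra hc
    have h2 := letter_eq_zero (v := v) le_rfl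
    have h3 := letter_pos_iff.2 (show len v < len w by omega)
    have h4 := letter_pos_iff.2 (show len v + 1 < len w by omega)
    have h5 : len v ∈ S := by
      by_contra hn
      rw [hlet, drop_of_notMem hn] at h2
      omega
    rw [hlet] at h2
    simp only [drop, h5, if_true] at h2
    rcases mem_reducibles.1 (hS h5) with h | h | h
    · omega
    · have h6 : len v = 0 := by
        by_contra hn
        have := h.2 0 (by omega)
        have := letter_pos_iff.2 (show 0 < len w by omega)
        omega
      rw [← hlet, letter_pos_iff] at hz
      omega
    · have := h.2.2 (len v + 1) (by omega)
      omega
  · rw [hlet]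
    have := letter_pos_iff.2 hj
    unfold drop
    split_ifs <;> omega
  · ext j
    rw [mem_dropped, hlet]
    unfold drop
    split_ifs with h
    · have := hpos j h
      simp only [h, iff_true]
      omega
    · simp [h]

/-- The factor `p` is the leftmost later occurrence of `y` in the base, extended by ones to the end.
An outer factor that is longer and contains `p` would yield a later occurrence further left.
Tightness says that no `y1^r` with `r ≤ i` is a suffix of the reduced word, which gives both the
principal factor property and `IsCounted`. -/
theorem exists_principalPair {y w : PWord} {S : Finset ℕ} (hy : ¬ Flat y)
    (hS : S ⊆ reducibles w) (h : IsTight y w S) :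
    ∃ v p, (v, p) ∈ principalPairs w ∧ IsCounted y v p ∧ dropped v w = S := by
  classical
  have hlt := excessIndex_lt_of_isTight hy hS h
  obtain ⟨hk, h0, hex, hno⟩ := h
  have hyl := len_pos_of_not_flat hy
  obtain ⟨v, hlet, hbase, hdr⟩ := exists_letter_eq_drop hS hyl h0
  rw [drop_insert hk] at hno
  rw [← hlet] at h0 hex hno
  obtain ⟨a, ⟨ha, hfa⟩, hmin⟩ :
      ∃ a, (a > 0 ∧ Fits y (letter v) a) ∧ ∀ b, b > 0 ∧ Fits y (letter v) b → a ≤ b :=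
    ⟨Nat.find hex, Nat.find_spec hex, fun b hb => Nat.find_min' hex hb⟩
  have hfw : Fits y (letter w) a := by
    rw [hlet] at hfa
    exact hfa.mono (drop_le w S)
  have hexc : excessIndex y v = excessIndex y w :=
    excessIndex_congr hy ha hfw fun k hk' => by
      rw [hlet, drop_of_notMem fun hkS => absurd (hlt k hkS) (by omega)]
  have hmem := excessIndex_mem hy ha hfa
  have hal := hfa.add_le_len hyl
  obtain ⟨i, hi⟩ := Nat.exists_eq_add_of_le hal
  have hred := letter_reduce hmem.1
  have hlred := len_reduce hmem.1
  have hout : IsOuter (withOnes y i) v := by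
    rw [isOuter_iff, len_withOnes, show len v - (len y + i) = a by omega]
    exact ⟨by omega, h0.withOnes fun j h1 h2 => letter_pos_iff.2 (by omega),
      hfa.withOnes fun j h1 h2 => letter_pos_iff.2 (by omega)⟩
  have hpi := principalIndex_withOnes hy hout
  have hcut : ∀ r ≤ i, ¬ Fits (withOnes y r) (letter (reduce v (excessIndex y v)))
      (len (reduce v (excessIndex y v)) - (len y + r)) := by
    intro r hr hf
    rw [hlred, hred, hexc] at hf
    exact hno ⟨_, by omega, hf.of_withOnes⟩
  refine ⟨v, withOnes y i, ⟨hbase, ⟨⟨hout, fun q hq hlq hle => ?_⟩, ?_, ?_⟩, ?_⟩,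
    ⟨i, rfl, fun r hr => ?_⟩, hdr⟩
  · obtain ⟨b, hb⟩ := le_iff_fits.1 hle
    have hbl := hb.add_le_len (by rw [len_withOnes]; omega)
    change IsOuter q v at hq
    obtain ⟨q1, q2, q3⟩ := isOuter_iff.1 hq
    rw [len_withOnes] at hlq hbl
    -- If `p` is at the beginning of `q`, use `q` as a suffix of `v`; otherwise use it as a prefix.
    -- Either way `y` occurs at a positive place before `a`.
    rcases Nat.eq_zero_or_pos b with rfl | hb0
    · have := hmin (len v - len q) ⟨by omega, fun j hj => ?_⟩
      · omega
      · have h1 := hb.of_withOnes j hj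
        rw [zero_add] at h1
        exact h1.trans (q3 j (by omega))
    · have := hmin b ⟨hb0, fun j hj => ?_⟩
      · omega
      · have h1 := q2 (b + j) (by omega)
        rw [zero_add] at h1
        exact (hb.of_withOnes j hj).trans h1
  · rwa [flat_withOnes]
  · rw [hpi, isSuffix_iff]
    intro hs
    have := hs.2
    rw [len_withOnes] at this
    exact hcut i le_rfl this
  · dsimp only
    rw [hpi, lt_firstDrop_iff, hdr, hexc]
    · exact hlt
    · have := letter_pos_iff.1 (show 0 < letter v (excessIndex y v) by omega)
      exact this.trans_le hbase.le.len_le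
  · rw [hpi, isOuter_iff]
    intro ho
    have := ho.2.2
    rw [len_withOnes] at this
    exact hcut r hr.le this

open Classical in
theorem signedCount_isTight {y w : PWord} (hy : ¬ Flat y) :
    signedCount (reducibles w) (IsTight y w) =
      ∑ q ∈ (principalPairs_finite w).toFinset,
        (-1) ^ degree q.1 w * (if IsCounted y q.1 q.2 then 1 else 0) := by
  simp only [mul_ite, mul_one, mul_zero]
  rw [← Finset.sum_filter]
  symm
  refine Finset.sum_bij (fun q _ => dropped q.1 w) ?_ ?_ ?_ fun q _ => rfl
  · rintro ⟨v, p⟩ hq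
    rw [Finset.mem_filter, Set.Finite.mem_toFinset] at hq
    rw [Finset.mem_filter, Finset.mem_powerset]
    exact isTight_dropped hy hq.1 hq.2
  · rintro ⟨v, p⟩ hq ⟨v', p'⟩ hq' h
    rw [Finset.mem_filter, Set.Finite.mem_toFinset] at hq hq'
    obtain ⟨rfl, rfl⟩ := eq_of_dropped_eq hq.1 hq.2 hq'.1 hq'.2 h
    rfl
  · intro S hS
    rw [Finset.mem_filter, Finset.mem_powerset] at hS
    obtain ⟨v, p, h1, h2, h3⟩ := exists_principalPair hy hS.1 hS.2
    exact ⟨(v, p), Finset.mem_filter.2 ⟨(Set.Finite.mem_toFinset _).2 h1, h2⟩, h3⟩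

-- For `y = w` only `d(w, w) = 1` remains, as principal factors are shorter than `w`; for flat `y`
-- no principal factor is counted, as these are not flat.
open Classical in
theorem sum_dTerm_eq (y w : PWord) (h : y ≤ w) :
    ∑ u ∈ Finset.Icc y w, dTerm u w = (if y = w then 1 else 0) -
      ∑ q ∈ (principalPairs_finite w).toFinset,
        (-1) ^ degree q.1 w * (if IsCounted y q.1 q.2 then 1 else 0) := by
  by_cases hyw : y = w
  · subst hyw
    have hz : ∑ q ∈ (principalPairs_finite y).toFinset,
        (-1 : ℤ) ^ degree q.1 y * (if IsCounted y q.1 q.2 then 1 else 0) = 0 := by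
      refine Finset.sum_eq_zero fun q hq => ?_
      rw [Set.Finite.mem_toFinset] at hq
      rw [if_neg, mul_zero]
      rintro ⟨i, hi, -⟩
      have h1 := hq.2.1.1.1.1
      have h2 := hq.1.le.len_le
      rw [hi, len_withOnes] at h1
      omega
    rw [hz]
    simp [dTerm]
  rw [if_neg hyw, zero_sub, sum_dTerm]
  change signedCount (reducibles w) (fun S => ∃ a, Fits y (drop w S) a) = _
  by_cases hy : Flat y
  · rw [signedCount_fits_flat hy hyw, Finset.sum_eq_zero fun q hq => ?_, neg_zero]
    rw [Set.Finite.mem_toFinset] at hq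
    rw [if_neg, mul_zero]
    rintro ⟨i, hi, -⟩
    have h1 := hq.2.1.2.1
    rw [hi, flat_withOnes] at h1
    exact h1 hy
  · rw [signedCount_fits_not_flat hy hyw, signedCount_isTight hy]

/-! ### Möbius inversion -/

theorem stripOnes_eq_some {v x : PWord} {m : ℕ} : stripOnes v m = some x ↔ v = withOnes x m := by
  unfold stripOnes
  constructor
  · intro h
    split_ifs at h with hs
    obtain ⟨t, ht⟩ := hs
    simp only [Option.some.injEq] at h
    subst h
    refine PWord.ext ?_
    simp [withOnes, len, ← ht]
  · rintro rfl
    rw [if_pos ⟨x.letters, rfl⟩]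
    simp [withOnes, len]

theorem le_withOnes (y : PWord) (i : ℕ) : y ≤ withOnes y i :=
  le_iff_fits.2 ⟨0, fun j _ => by rw [zero_add]; exact letter_le_letter_withOnes y i j⟩

theorem sum_mu {y x w : PWord} (h : x ≤ w) :
    ∑ u ∈ Finset.Icc y w, IncidenceAlgebra.mu ℤ u x = if y = x then 1 else 0 := by
  rw [← IncidenceAlgebra.sum_Icc_mu_left]
  symm
  refine Finset.sum_subset (Finset.Icc_subset_Icc_right h) fun u hu hu' => ?_
  refine IncidenceAlgebra.apply_eq_zero_of_not_le (fun hux => hu' ?_) _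
  exact Finset.mem_Icc.2 ⟨(Finset.mem_Icc.1 hu).1, hux⟩

-- Each summand of `ν` contributes `1` exactly when `p ∖ 1^i = y`, and lengths allow this for at
-- most one `i`.
open Classical in
theorem sum_nu {y p w : PWord} (h : p ≤ w) :
    ∑ u ∈ Finset.Icc y w, nu u (some p) = if ∃ i, p = withOnes y i then 1 else 0 := by
  simp only [nu, Option.elim_some]
  rw [Finset.sum_comm]
  have key : ∀ i, ∑ u ∈ Finset.Icc y w, muOpt u (stripOnes p i) =
      if p = withOnes y i then 1 else 0 := by
    intro i
    cases hx : stripOnes p i with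
    | none =>
      rw [if_neg fun e => by rw [stripOnes_eq_some.2 e] at hx; simp at hx]
      simp [muOpt]
    | some x =>
      simp only [muOpt, Option.elim_some]
      have hx' := stripOnes_eq_some.1 hx
      rw [sum_mu ((hx' ▸ le_withOnes x i : x ≤ p).trans h)]
      refine if_congr ⟨fun e => e ▸ hx', fun e => ?_⟩ rfl rfl
      exact withOnes_injective i (e.symm.trans hx')
  rw [Finset.sum_congr rfl fun i _ => key i]
  split_ifs with hi
  · obtain ⟨i, rfl⟩ := hi
    rw [Finset.sum_eq_single i, if_pos rfl]
    · intro j _ hj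
      refine if_neg fun e => hj ?_
      have := congrArg len e
      rw [len_withOnes, len_withOnes] at this
      omega
    · intro hi
      rw [Finset.mem_range, len_withOnes] at hi
      omega
  · exact Finset.sum_eq_zero fun i _ => if_neg fun e => hi ⟨i, e⟩

-- Write `p = y1^i`. If the primary prefix removes `m` ones, its sum counts the cases `i ≥ m`, so
-- the difference counts `i < m`. Minimality of `m` turns this into the condition that no `y1^r`
-- with `r < i` is an outer factor of the reduced word. Without a primary prefix that condition
-- always holds.
open Classical in
theorem sum_nu_sub_nu {y p v w : PWord} (h : p ≤ w) :
    ∑ u ∈ Finset.Icc y w, (nu u (some p) - nu u (primaryPrefix p v)) =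
      if IsCounted y v p then 1 else 0 := by
  rw [Finset.sum_sub_distrib, sum_nu h]
  by_cases hex : ∃ m, 0 < m ∧ ∃ x, stripOnes p m = some x ∧
      IsOuter x (reduce v (principalIndex p v))
  · have hpp : primaryPrefix p v = stripOnes p (Nat.find hex) := by
      unfold primaryPrefix
      rw [dif_pos hex]
    obtain ⟨hm, x, hx, hox⟩ := Nat.find_spec hex
    have hmin := fun m hm => Nat.find_min' hex (m := m) hm
    set m := Nat.find hex
    rw [hpp, hx]
    have hx' := stripOnes_eq_some.1 hx
    rw [sum_nu ((hx' ▸ le_withOnes x m : x ≤ p).trans h)]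
    by_cases hi : ∃ i, p = withOnes y i
    · rw [if_pos hi]
      obtain ⟨i, hi⟩ := hi
      by_cases hmi : m ≤ i
      · have hxy : x = withOnes y (i - m) := withOnes_injective m (by
          show withOnes x m = withOnes (withOnes y (i - m)) m
          rw [withOnes_add, Nat.sub_add_cancel hmi, ← hi, hx'])
        rw [if_pos ⟨_, hxy⟩, if_neg, sub_self]
        rintro ⟨i', hi', hr⟩
        have := congrArg len (hi.symm.trans hi')
        rw [len_withOnes, len_withOnes] at this
        exact hr (i - m) (by omega) (hxy ▸ hox)
      · rw [if_neg, if_pos, sub_zero]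
        · refine ⟨i, hi, fun r hr ho => hmi ?_⟩
          refine (hmin (i - r) ⟨by omega, withOnes y r, stripOnes_eq_some.2 ?_, ho⟩).trans
            (Nat.sub_le _ _)
          rw [withOnes_add, hi]
          congr 1
          omega
        · rintro ⟨j, rfl⟩
          rw [hx', withOnes_add] at hi
          have := congrArg len hi
          rw [len_withOnes, len_withOnes] at this
          omega
    · rw [if_neg hi, if_neg, if_neg, sub_self]
      · exact fun ⟨i, hi', _⟩ => hi ⟨i, hi'⟩
      · rintro ⟨j, rfl⟩
        exact hi ⟨j + m, by rw [hx', withOnes_add]⟩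
  · have hpp : primaryPrefix p v = none := by
      unfold primaryPrefix
      rw [dif_neg hex]
    rw [hpp]
    simp only [nu, Option.elim_none, Finset.sum_const_zero, sub_zero]
    refine if_congr ⟨fun ⟨i, hi⟩ => ⟨i, hi, fun r hr ho => hex ?_⟩, fun ⟨i, hi, _⟩ => ⟨i, hi⟩⟩ rfl rfl
    refine ⟨i - r, by omega, withOnes y r, stripOnes_eq_some.2 ?_, ho⟩
    rw [withOnes_add, hi]
    congr 1
    omega

/-- Induction on `ρ(y, w)`: all terms of the sum over `[y, w]` other than `E y` vanish already. -/
theorem eq_zero_of_sum_Icc_eq_zero {w : PWord} {E : PWord → ℤ}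
    (h : ∀ y ≤ w, ∑ u ∈ Finset.Icc y w, E u = 0) {y : PWord} (hy : y ≤ w) : E y = 0 := by
  obtain ⟨n, hn⟩ : ∃ n, rank w - rank y = n := ⟨_, rfl⟩
  induction n using Nat.strong_induction_on generalizing y with
  | _ n ih =>
    have := h y hy
    rw [Finset.Icc_eq_cons_Ioc hy, Finset.sum_cons, Finset.sum_eq_zero fun u hu => ?_,
      add_zero] at this
    · exact this
    · rw [Finset.mem_Ioc] at hu
      have h1 := rank_strictMono hu.1
      have h2 := rank_strictMono.monotone hu.2
      exact ih (rank w - rank u) (by omega) hu.2 rfl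

end PWord

theorem mainTheorem2 (u w : PWord) (huw : u ≤ w) :
    IncidenceAlgebra.mu ℤ u w =
      PWord.dTerm u w +
        ∑ q ∈ (PWord.principalPairs_finite w).toFinset,
          (-1 : ℤ) ^ PWord.degree q.1 w *
            (PWord.nu u (some q.2) - PWord.nu u (PWord.primaryPrefix q.2 q.1)) := by
  classical
  rw [← sub_eq_zero]
  -- `E` is the difference of the two sides; `sum_dTerm_eq` and `sum_nu_sub_nu` make its sums
  -- vanish.
  refine PWord.eq_zero_of_sum_Icc_eq_zero (w := w) (E := fun u => IncidenceAlgebra.mu ℤ u w -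
    (PWord.dTerm u w + ∑ q ∈ (PWord.principalPairs_finite w).toFinset,
      (-1 : ℤ) ^ PWord.degree q.1 w *
        (PWord.nu u (some q.2) - PWord.nu u (PWord.primaryPrefix q.2 q.1)))) (fun y hy => ?_) huw
  have key : ∀ q ∈ (PWord.principalPairs_finite w).toFinset,
      ∑ u ∈ Finset.Icc y w, (-1 : ℤ) ^ PWord.degree q.1 w *
        (PWord.nu u (some q.2) - PWord.nu u (PWord.primaryPrefix q.2 q.1)) =
      (-1) ^ PWord.degree q.1 w * (if PWord.IsCounted y q.1 q.2 then 1 else 0) := by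
    intro q hq
    rw [Set.Finite.mem_toFinset] at hq
    rw [← Finset.mul_sum,
      PWord.sum_nu_sub_nu ((PWord.IsPrefix.le hq.2.1.1.1.2.1).trans hq.1.le)]
  rw [Finset.sum_sub_distrib, Finset.sum_add_distrib, Finset.sum_comm (s := Finset.Icc y w),
    Finset.sum_congr rfl key, PWord.sum_dTerm_eq y w hy, PWord.sum_mu le_rfl]
  ring
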